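/- Let $k$ be a field, let $1\le n\le m$, let $R=k[x_{ij}\mid 1\le i\le n,\ 1\le j\le m]$ with its standard grading and let $M=(x_{ij})$ be the generic $n\times m$ matrix. Let $<$ be the lexicographic order with $x_{11}>\dots>x_{1m}>x_{21}>\dots>x_{nm}$. Let $\Delta$ be a simplicial complex on the vertex set $[m]$ that has a face of cardinality $n$ (that is, $\dim\Delta\ge n-1$). A set $\sigma=\{\sigma_1<\dots<\sigma_\ell\}\subseteq[m]$ is a *$1$-nonface* of $\Delta$ if $\sigma\notin\Delta$ and $\sigma\setminus\{\sigma_j\}\in\Delta$ and $\sigma\setminus\{\sigma_{j+1}\}\in\Delta$ for some $1\le j<\ell$. The *generalized sparse Eagon–Northcott complex* $\mathcal C=\mathcal C^<_\bullet(\Delta,M)$ is the following complex of graded free $R$-modules. $\mathcal C_0=R$, and for $i\ge1$, $\mathcal C_i$ is free with basis the elements $g^{*(\alpha)}\otimes f_\sigma$ of degree $n+i-1$, where $\alpha\in\mathbb N^n$, $|\alpha|=i-1$, $\sigma\in\Delta$ and $|\sigma|=n+i-1$. The map $d_1$ sends $f_\sigma$ to the initial term with respect to $<$ of the maximal minor of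 $M$ on the columns in $\sigma$. For $i\ge2$ and $\sigma=\{\sigma_1<\dots<\sigma_{n+i-1}\}$, $$d_i(g^{*(\alpha)}\otimes f_\sigma)=\sum_{l:\ \alpha_l>0}\ \ \sum_{j=l+\alpha_1+\dots+\alpha_{l-1}}^{l+\alpha_1+\dots+\alpha_l}(-1)^{j+1}x_{l\sigma_j}\,g^{*(\alpha-\epsilon_l)}\otimes f_{\sigma\setminus\{\sigma_j\}} .$$ For a finitely generated graded $R$-module $N$ of initial degree $n$ (the least degree in which $N$ is nonzero) with minimal graded free resolution $F_\bullet$, the *linear strand* of $N$ is the subcomplex $F^{\mathrm{lin}}_\bullet$ of $F_\bullet$ in which $F^{\mathrm{lin}}_i$ is spanned by the basis elements of $F_i$ of degree $i+n$. Suppose that $\Delta$ has no $1$-nonfaces of cardinality $\ge n+1$. Then: 1. $\mathcal C$ is, up to the augmentation $\mathcal C_0=R$, the linear strand of a finitely generated graded $R$-module of initial degree $n$: there are a finitely generated graded $R$-module $N$ of initial degree $n$ with minimal graded free resolution $F_\bullet\to N$, an isomorphism of complexes of graded $R$-modules from $\cdots\to\mathcal C_3\to\mathcal C_2\to\mathcal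 C_1$ (with $\mathcal C_{i+1}$ placed in homological degree $i$) to $F^{\mathrm{lin}}_\bullet$, and an injective homogeneous map $N\to R$ of degree $0$ such that $d_1$ is the composite $\mathcal C_1\cong F^{\mathrm{lin}}_0\subseteq F_0\to N\to R$. 2. $H_i(\mathcal C)_{i+n-1}=0$ and $H_i(\mathcal C)_{i+n}=0$ for all $i\ge1$. -/

import Mathlib

open MvPolynomial

universe u

noncomputable section

/-! ### Complexes of graded free modules over a standard graded polynomial ring -/

/-- A complex `⋯ → X 2 → X 1 → X 0` of finitely generated graded free modules over the standard
graded polynomial ring `k[V]`, with chosen homogeneous bases: `X i` is the free module on `B i`,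
the basis vector `b` sits in degree `deg i b`, and the differentials are homogeneous of degree 0. -/
structure GradedFreeComplex (V : Type) (k : Type u) [Field k] where
  B : ℕ → Type
  finite_B : ∀ i, Finite (B i)
  deg : ∀ i, B i → ℕ
  d : ∀ i, (B (i + 1) →₀ MvPolynomial V k) →ₗ[MvPolynomial V k] (B i →₀ MvPolynomial V k)
  homogeneous_d : ∀ i b c s, (d i (Finsupp.single b 1) c).coeff s ≠ 0 →
    s.degree + deg i c = deg (i + 1) b
  d_comp_d : ∀ i, d i ∘ₗ d (i + 1) = 0

namespace GradedFreeComplex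

variable {V : Type} {k : Type u} [Field k] (C : GradedFreeComplex V k)

/-- The module in homological degree `i`. -/
abbrev X (i : ℕ) : Type u := C.B i →₀ MvPolynomial V k

/-- The homogeneous component of internal degree `e` of `X i`. -/
def piece (i e : ℕ) : AddSubgroup (C.X i) where
  carrier := {v | ∀ c s, (v c).coeff s ≠ 0 → s.degree + C.deg i c = e}
  zero_mem' := by intro c s h; simp at h
  add_mem' := by
    intro v w hv hw c s h
    by_cases h1 : (v c).coeff s = 0
    · refine hw c s fun h2 => h ?_
      simp [h1, h2]
    · exact hv c s h1
  neg_mem' := by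
    intro v hv c s h
    refine hv c s fun h1 => h ?_
    simp [h1]

/-- The cycles in homological degree `i`. -/
def cycles : (i : ℕ) → AddSubgroup (C.X i)
  | 0 => ⊤
  | i + 1 => (C.d i).toAddMonoidHom.ker

/-- The component `H_i(C)_e` of internal degree `e` of the `i`-th homology: cycles of internal
degree `e` modulo boundaries of elements of internal degree `e`. -/
abbrev homology (i e : ℕ) : Type u :=
  ↥(C.cycles i ⊓ C.piece i e) ⧸
    ((C.piece (i + 1) e).map (C.d i).toAddMonoidHom).addSubgroupOf (C.cycles i ⊓ C.piece i e)

/-- The complex `⋯ → X 3 → X 2 → X 1`, reindexed to start in homological degree `0`. -/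
def tail : GradedFreeComplex V k where
  B i := C.B (i + 1)
  finite_B i := C.finite_B (i + 1)
  deg i := C.deg (i + 1)
  d i := C.d (i + 1)
  homogeneous_d i := C.homogeneous_d (i + 1)
  d_comp_d i := C.d_comp_d (i + 1)

/-- The summand of `X i` spanned by the basis vectors of degree `i + n`. If `C` is a minimal free
resolution of a module with initial degree `n`, these submodules form its linear strand. -/
def linearPart (n i : ℕ) : Submodule (MvPolynomial V k) (C.X i) :=
  Submodule.span _ {v | ∃ b, C.deg i b = i + n ∧ v = Finsupp.single b 1}

end GradedFreeComplex

/-- `𝒩` makes the `k[V]`-module `N` a (nonnegatively) graded module over `k[V]` with its standard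
grading. -/
structure IsGradedModule {V : Type} {k : Type u} [Field k] {N : Type u} [AddCommGroup N]
    [Module (MvPolynomial V k) N] (𝒩 : ℕ → AddSubgroup N) : Prop where
  isInternal : DirectSum.IsInternal 𝒩
  smul_mem : ∀ (i j : ℕ) (r : MvPolynomial V k) (x : N),
    r ∈ homogeneousSubmodule V k i → x ∈ 𝒩 j → r • x ∈ 𝒩 (i + j)

/-- The initial degree of a graded module, the least degree of a nonzero homogeneous component,
is `n`. -/
def HasInitialDegree {N : Type u} [AddCommGroup N] (𝒩 : ℕ → AddSubgroup N) (n : ℕ) : Prop :=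
  𝒩 n ≠ ⊥ ∧ ∀ j < n, 𝒩 j = ⊥

/-- A minimal graded free resolution of the graded module `(N, 𝒩)`. -/
structure MinimalFreeResolution {V : Type} {k : Type u} [Field k] {N : Type u} [AddCommGroup N]
    [Module (MvPolynomial V k) N] (𝒩 : ℕ → AddSubgroup N) where
  F : GradedFreeComplex V k
  ε : F.X 0 →ₗ[MvPolynomial V k] N
  homogeneous_ε : ∀ b, ε (Finsupp.single b 1) ∈ 𝒩 (F.deg 0 b)
  surjective_ε : Function.Surjective ε
  exact_zero : LinearMap.ker ε = LinearMap.range (F.d 0)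
  exact_succ : ∀ i, LinearMap.ker (F.d i) = LinearMap.range (F.d (i + 1))
  minimal : ∀ i b c, constantCoeff (F.d i (Finsupp.single b 1) c) = 0

/-- An isomorphism of complexes of graded modules from `G` onto the linear strand (starting in
degree `n`) of the complex `F`, written as an injective chain map into `F` whose image is the
linear strand. -/
structure LinearStrandIso {V : Type} {k : Type u} [Field k] (G F : GradedFreeComplex V k)
    (n : ℕ) where
  φ : ∀ i, G.X i →ₗ[MvPolynomial V k] F.X i
  injective : ∀ i, Function.Injective (φ i)
  range_eq : ∀ i, LinearMap.range (φ i) = F.linearPart n i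
  homogeneous : ∀ i e v, v ∈ G.piece i e → φ i v ∈ F.piece i e
  comm : ∀ i v, φ i (G.d i v) = F.d i (φ (i + 1) v)

/-- The complex `C`, with `C.X 0` regarded as an augmentation, is the linear strand of the graded
module `(N, 𝒩)` of initial degree `n`: the part `⋯ → C.X 2 → C.X 1` is isomorphic to the linear
strand of a minimal graded free resolution `F` of `N`, and the last map `C.X 1 → C.X 0` is the
composite of this isomorphism, the augmentation `F.X 0 → N`, and a homogeneous embedding of `N`
into `C.X 0`. -/
def IsAugmentedLinearStrand {V : Type} {k : Type u} [Field k] (C : GradedFreeComplex V k)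
    {N : Type u} [AddCommGroup N] [Module (MvPolynomial V k) N] (𝒩 : ℕ → AddSubgroup N)
    (n : ℕ) : Prop :=
  ∃ (P : MinimalFreeResolution (V := V) (k := k) 𝒩) (Φ : LinearStrandIso C.tail P.F n)
    (ι : N →ₗ[MvPolynomial V k] C.X 0),
    Function.Injective ι ∧ (∀ e, ∀ x ∈ 𝒩 e, ι x ∈ C.piece 0 e) ∧
      ∀ v : C.X 1, C.d 0 v = ι (P.ε (Φ.φ 0 v))

/-! ### Nonfaces -/

/-- `σ = {σ_0 < σ_1 < ⋯}` is an `i`-nonface of `Δ`: it is not a face, but for some `j` all of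
`σ_j, …, σ_{j+i}` exist and removing any one of them from `σ` gives a face. -/
def IsNonface {m : ℕ} (Δ : PreAbstractSimplicialComplex (Fin m)) (i : ℕ) (σ : Finset (Fin m)) :
    Prop :=
  σ ∉ Δ ∧ ∃ (j : ℕ) (h : j + i < σ.card), ∀ (l : ℕ) (hl : l ≤ i),
    σ.erase (σ.orderEmbOfFin rfl ⟨j + l, by omega⟩) ∈ Δ

/-! ### The generalized sparse Eagon-Northcott complex -/

namespace SparseEN

variable {n m : ℕ} {k : Type u} [Field k]

/-- The variables `x_{ij}`, ordered row by row: `x_{11}, …, x_{1m}, x_{21}, …`. -/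
abbrev Vars (n m : ℕ) : Type := Fin n ×ₗ Fin m

variable (n m k) in
/-- The coordinate ring of `n × m` matrices. -/
abbrev Ring : Type u := MvPolynomial (Vars n m) k

variable (n m k) in
/-- The generic `n × m` matrix. -/
def genericMatrix : Matrix (Fin n) (Fin m) (Ring n m k) :=
  Matrix.of fun i j => X (toLex (i, j))

variable (k) in
/-- The maximal minor of the generic matrix on the columns in `σ`, which is the coefficient of
`M(f_σ)` at the basis vector `g_1 ∧ ⋯ ∧ g_n`. -/
def minor (σ : Finset (Fin m)) (h : σ.card = n) : Ring n m k :=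
  ((genericMatrix n m k).submatrix id (σ.orderEmbOfFin h)).det

variable (k) in
/-- The initial term of a maximal minor, for the lexicographic order with
`x_{11} > ⋯ > x_{1m} > x_{21} > ⋯`. -/
def initialMinor (σ : Finset (Fin m)) (h : σ.card = n) : Ring n m k :=
  (MonomialOrder.lex (σ := Vars n m)).leadingTerm (minor k σ h)

/-- The position of `a` in the increasing enumeration of `σ`, counted from `0`. -/
def pos (σ : Finset (Fin m)) (a : Fin m) : ℕ := (σ.filter (· < a)).card

/-- The set of pairs `(i, I_{i+j})` with `α_i > 0` and
`α_1 + ⋯ + α_{i-1} ≤ j ≤ α_1 + ⋯ + α_i`. Rows and positions are counted from `0` here, which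
changes both `i` and the position `i + j` by one. -/
def indexSet (α : Fin n → ℕ) (I : Finset (Fin m)) : Finset (Fin n × Fin m) :=
  Finset.univ.filter fun q => 0 < α q.1 ∧ q.2 ∈ I ∧
    q.1 + ∑ l ∈ Finset.Iio q.1, α l ≤ pos I q.2 ∧ pos I q.2 ≤ q.1 + ∑ l ∈ Finset.Iic q.1, α l

/-- The pairs `(α, σ)` that index the basis elements `g^{*(α)} ⊗ f_σ` of the module in homological
degree `i + 1`. -/
abbrev Idx (n : ℕ) (Δ : PreAbstractSimplicialComplex (Fin m)) (i : ℕ) : Type :=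
  {p : (Fin n → ℕ) × Finset (Fin m) // p.2 ∈ Δ ∧ p.2.card = n + i ∧ ∑ l, p.1 l = i}

variable {Δ : PreAbstractSimplicialComplex (Fin m)}

theorem sum_sub_single (α : Fin n → ℕ) (i : Fin n) (hi : 0 < α i) (s : Finset (Fin n)) :
    ∑ l ∈ s, (α - Pi.single i 1 : Fin n → ℕ) l + (if i ∈ s then 1 else 0) = ∑ l ∈ s, α l := by
  have : ∀ l, α l = (α - Pi.single i 1 : Fin n → ℕ) l + (if i = l then 1 else 0) := by
    intro l
    by_cases h : i = l
    · subst h; simp; omega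
    · simp [h, Ne.symm h]
  rw [Finset.sum_congr rfl fun l _ => this l, Finset.sum_add_distrib]
  simp

/-- The index `(α - ε_i, σ ∖ a)` for `(i, a)` in the indexing set of `(α, σ)`. -/
def Idx.remove {i : ℕ} (b : Idx n Δ (i + 1)) (q : Fin n × Fin m)
    (hq : q ∈ indexSet b.1.1 b.1.2) : Idx n Δ i :=
  ⟨(b.1.1 - Pi.single q.1 1, b.1.2.erase q.2), by
    have hb := b.2
    simp only [indexSet, Finset.mem_filter, Finset.mem_univ, true_and] at hq
    have hn : 0 < n := q.1.pos
    have hc : (b.1.2.erase q.2).card = n + i := by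
      have := hb.2.1
      rw [Finset.card_erase_of_mem hq.2.1]; omega
    refine ⟨(Δ.isRelLowerSet_faces hb.1).2 (Finset.erase_subset _ _) ?_, hc, ?_⟩
    · exact Finset.card_pos.1 (show 0 < (b.1.2.erase q.2).card by omega)
    · have := sum_sub_single b.1.1 q.1 hq.1 Finset.univ
      simp only [Finset.mem_univ, if_true] at this
      have h2 := hb.2.2
      simp only
      omega⟩

variable (n Δ) in
/-- Basis of the complex: one element in homological degree `0` (the vector `g_1 ∧ ⋯ ∧ g_n`), and
the elements `g^{*(α)} ⊗ f_σ` in positive homological degree. -/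
abbrev Basis : ℕ → Type
  | 0 => Unit
  | i + 1 => Idx n Δ i

variable (n Δ) in
/-- The internal degrees of the basis elements. -/
def degree : (i : ℕ) → Basis n Δ i → ℕ
  | 0, _ => 0
  | i + 1, _ => n + i

theorem card_eq (b : Idx n Δ 0) : b.1.2.card = n := b.2.2.1

/-- The image of a basis element of homological degree `i + 2` under the differential. The sign is
`(-1)^{j+1}` where `j` is the position counted from `1`. -/
def dIdx {i : ℕ} (b : Idx n Δ (i + 1)) : Idx n Δ i →₀ Ring n m k :=
  ∑ q ∈ (indexSet b.1.1 b.1.2).attach,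
    Finsupp.single (b.remove q.1 q.2) ((-1) ^ pos b.1.2 q.1.2 * X (toLex q.1))

/-- The image of a basis element under the differential. -/
def dBasis : (i : ℕ) → Basis n Δ (i + 1) → (Basis n Δ i →₀ Ring n m k)
  | 0, (b : Idx n Δ 0) => Finsupp.single () (initialMinor k b.1.2 (card_eq b))
  | i + 1, (b : Idx n Δ (i + 1)) => (dIdx b : Idx n Δ i →₀ Ring n m k)

/-- The differential. -/
def diff (i : ℕ) :
    (Basis n Δ (i + 1) →₀ Ring n m k) →ₗ[Ring n m k] (Basis n Δ i →₀ Ring n m k) :=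
  Finsupp.linearCombination _ (dBasis i)

theorem pos_erase {σ : Finset (Fin m)} {a : Fin m} (ha : a ∈ σ) (b : Fin m) :
    pos (σ.erase a) b + (if a < b then 1 else 0) = pos σ b := by
  unfold pos
  rw [Finset.filter_erase]
  split_ifs with h
  · exact Finset.card_erase_add_one (by simp [ha, h])
  · rw [Finset.erase_eq_of_notMem (by simp [h])]; rfl

theorem pos_lt {σ : Finset (Fin m)} {a b : Fin m} (ha : a ∈ σ) (h : a < b) :
    pos σ a < pos σ b := by
  apply Finset.card_lt_card
  rw [Finset.ssubset_iff_of_subset]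
  · exact ⟨a, by simp [ha, h], by simp⟩
  · intro c hc
    simp only [Finset.mem_filter] at hc ⊢
    exact ⟨hc.1, hc.2.trans h⟩

theorem indexSet_swap {α : Fin n → ℕ} {σ : Finset (Fin m)} {q r : Fin n × Fin m}
    (hq : q ∈ indexSet α σ) (hr : r ∈ indexSet (α - Pi.single q.1 1) (σ.erase q.2)) :
    r ∈ indexSet α σ ∧ q ∈ indexSet (α - Pi.single r.1 1) (σ.erase r.2) := by
  obtain ⟨i, a⟩ := q
  obtain ⟨j, b⟩ := r
  simp only [indexSet, Finset.mem_filter, Finset.mem_univ, true_and, Finset.mem_erase] at hq hr ⊢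
  obtain ⟨hi, ha, h1, h2⟩ := hq
  obtain ⟨hj, ⟨hba, hb⟩, h3, h4⟩ := hr
  have hj' : 0 < α j := lt_of_lt_of_le hj (by simp)
  have e1 := sum_sub_single α i hi (Finset.Iio j)
  have e2 := sum_sub_single α i hi (Finset.Iic j)
  have e3 := sum_sub_single α j hj' (Finset.Iio i)
  have e4 := sum_sub_single α j hj' (Finset.Iic i)
  have p1 := pos_erase ha b
  have p2 := pos_erase hb a
  have mono : ∀ x y : Fin n, x < y → ∑ l ∈ Finset.Iic x, α l ≤ ∑ l ∈ Finset.Iio y, α l := by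
    intro x y hxy
    apply Finset.sum_le_sum_of_subset
    intro l hl
    simp only [Finset.mem_Iic, Finset.mem_Iio] at hl ⊢
    exact lt_of_le_of_lt hl hxy
  simp only [Finset.mem_Iio, Finset.mem_Iic] at e1 e2 e3 e4
  have hab : a < b → pos σ a < pos σ b := pos_lt ha
  have hba' : b < a → pos σ b < pos σ a := pos_lt hb
  have hne : a < b ∨ b < a := lt_or_gt_of_ne (Ne.symm hba)
  rcases lt_trichotomy i j with hij | hij | hij
  · have hm := mono i j hij
    have hv : (i : ℕ) < j := hij
    simp only [hij, hij.le, hij.not_gt, hij.not_ge, if_true, if_false] at e1 e2 e3 e4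
    have hα : 0 < (α - Pi.single j 1 : Fin n → ℕ) i := by
      simp [hij.ne, hi]
    rcases hne with h | h
    · have := hab h
      simp only [h, h.not_gt, if_true, if_false] at p1 p2
      refine ⟨⟨hj', hb, ?_, ?_⟩, hα, ⟨Ne.symm hba, ha⟩, ?_, ?_⟩ <;> omega
    · have := hba' h
      simp only [h, h.not_gt, if_true, if_false] at p1 p2
      omega
  · subst hij
    simp only [lt_irrefl, le_refl, if_true, if_false] at e1 e2 e3 e4
    rcases hne with h | h
    · have := hab h
      simp only [h, h.not_gt, if_true, if_false] at p1 p2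
      refine ⟨⟨hj', hb, ?_, ?_⟩, hj, ⟨Ne.symm hba, ha⟩, ?_, ?_⟩ <;> omega
    · have := hba' h
      simp only [h, h.not_gt, if_true, if_false] at p1 p2
      refine ⟨⟨hj', hb, ?_, ?_⟩, hj, ⟨Ne.symm hba, ha⟩, ?_, ?_⟩ <;> omega
  · have hm := mono j i hij
    have hv : (j : ℕ) < i := hij
    simp only [hij, hij.le, hij.not_gt, hij.not_ge, if_true, if_false] at e1 e2 e3 e4
    have hα : 0 < (α - Pi.single j 1 : Fin n → ℕ) i := by
      simp [hij.ne', hi]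
    rcases hne with h | h
    · have := hab h
      simp only [h, h.not_gt, if_true, if_false] at p1 p2
      omega
    · have := hba' h
      simp only [h, h.not_gt, if_true, if_false] at p1 p2
      refine ⟨⟨hj', hb, ?_, ?_⟩, hα, ⟨Ne.symm hba, ha⟩, ?_, ?_⟩ <;> omega

theorem sign_swap {R : Type*} [CommRing R] {σ : Finset (Fin m)} {a b : Fin m} (ha : a ∈ σ)
    (hb : b ∈ σ) (hab : a ≠ b) (x y : R) :
    ((-1) ^ pos σ a * x) * ((-1) ^ pos (σ.erase a) b * y) +
      ((-1) ^ pos σ b * y) * ((-1) ^ pos (σ.erase b) a * x) = 0 := by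
  have p1 := pos_erase ha b
  have p2 := pos_erase hb a
  rcases lt_or_gt_of_ne hab with h | h
  · simp only [h, h.not_gt, if_true, if_false, add_zero] at p1 p2
    rw [← p1, p2, pow_succ]; ring
  · simp only [h, h.not_gt, if_true, if_false, add_zero] at p1 p2
    rw [← p2, p1, pow_succ]; ring

theorem diff_single (i : ℕ) (b : Basis n Δ (i + 1)) (r : Ring n m k) :
    diff i (Finsupp.single b r) = r • dBasis i b :=
  Finsupp.linearCombination_single _ _ _

theorem sum_dIdx {i : ℕ} (b : Idx n Δ (i + 2)) :
    ∑ q ∈ (indexSet b.1.1 b.1.2).attach, ((-1) ^ pos b.1.2 q.1.2 * X (toLex q.1) : Ring n m k) •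
      (dIdx (b.remove q.1 q.2) : Idx n Δ i →₀ Ring n m k) = 0 := by
  simp only [dIdx, Finset.smul_sum, Finsupp.smul_single, smul_eq_mul]
  rw [Finset.sum_sigma']
  have key : ∀ p : (q : {x // x ∈ indexSet b.1.1 b.1.2}) × {x // x ∈ indexSet
      (b.remove q.1 q.2).1.1 (b.remove q.1 q.2).1.2}, p.1.1.2 ∈ b.1.2 ∧ p.2.1.2 ∈ b.1.2 ∧
      p.1.1.2 ≠ p.2.1.2 := by
    rintro ⟨⟨q, hq⟩, ⟨r, hr⟩⟩
    simp only [Idx.remove, indexSet, Finset.mem_filter, Finset.mem_univ, true_and,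
      Finset.mem_erase] at hq hr ⊢
    exact ⟨hq.2.1, hr.2.1.2, Ne.symm hr.2.1.1⟩
  refine Finset.sum_involution (fun p _ => ⟨⟨p.2.1, (indexSet_swap p.1.2 p.2.2).1⟩,
    ⟨p.1.1, (indexSet_swap p.1.2 p.2.2).2⟩⟩) ?_ ?_ ?_ ?_
  · intro p _
    have e : (b.remove p.2.1 (indexSet_swap p.1.2 p.2.2).1).remove p.1.1
        (indexSet_swap p.1.2 p.2.2).2 = (b.remove p.1.1 p.1.2).remove p.2.1 p.2.2 := by
      apply Subtype.ext
      simp only [Idx.remove]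
      rw [Finset.erase_right_comm, tsub_right_comm]
    simp only [e]
    rw [← Finsupp.single_add]
    rw [Finsupp.single_eq_zero]
    obtain ⟨h1, h2, h3⟩ := key p
    exact sign_swap h1 h2 h3 _ _
  · intro p _ _ h
    have := congrArg (fun z => z.1.1.2) h
    exact (key p).2.2 this.symm
  · intro p _
    simp
  · intro p _
    rfl

theorem diff_diff_succ (i : ℕ) :
    (diff (i + 1) ∘ₗ diff (i + 2) : (Basis n Δ (i + 3) →₀ Ring n m k) →ₗ[Ring n m k] _) = 0 := by
  refine Finsupp.lhom_ext fun b r => ?_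
  rw [LinearMap.comp_apply, diff_single, map_smul]
  have : diff (i + 1) (dBasis (i + 2) b) = (0 : Basis n Δ (i + 1) →₀ Ring n m k) := by
    refine Eq.trans ?_ (sum_dIdx b)
    refine (map_sum (diff (i + 1)) _ _).trans (Finset.sum_congr rfl fun q _ => ?_)
    exact diff_single (i + 1) _ _
  rw [this, smul_zero, LinearMap.zero_apply]

/-- The exponent vector of `∏ i, x_{p(i), s(i)}`. -/
def permExp (s : Fin n → Fin m) (p : Equiv.Perm (Fin n)) : Vars n m →₀ ℕ :=
  ∑ i, Finsupp.single (toLex (p i, s i)) 1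

theorem permExp_apply (s : Fin n → Fin m) (p : Equiv.Perm (Fin n)) (r : Fin n) (c : Fin m) :
    permExp s p (toLex (r, c)) = if s (p.symm r) = c then 1 else 0 := by
  rw [permExp, Finsupp.finsetSum_apply, Finset.sum_eq_single (p.symm r)]
  · simp [Finsupp.single_apply]
  · intro i _ hi
    rw [Finsupp.single_apply, if_neg]
    intro h
    apply hi
    have := congrArg (fun z => (ofLex z).1) h
    simp only [ofLex_toLex] at this
    rw [← this, Equiv.symm_apply_apply]
  · simp

theorem permExp_lt {s : Fin n → Fin m} (hs : StrictMono s) {p : Equiv.Perm (Fin n)}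
    (hp : p ≠ 1) : toLex (permExp s p) < toLex (permExp s 1) := by
  have hex : ∃ r, p.symm r ≠ r := by
    by_contra! h
    apply hp
    ext r
    have := h (p r)
    rw [Equiv.symm_apply_apply] at this
    simp [← this]
  obtain ⟨r, hr, hmin⟩ := WellFounded.has_min (wellFounded_lt (α := Fin n)) {r | p.symm r ≠ r} hex
  have hfix : ∀ r' < r, p.symm r' = r' := fun r' h => by
    by_contra h'
    exact hmin r' h' h
  have hgt : r < p.symm r := by
    rcases lt_trichotomy (p.symm r) r with h | h | h
    · have := hfix _ h
      exact absurd (p.symm.injective this) h.ne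
    · exact absurd h hr
    · exact h
  rw [Finsupp.Lex.lt_iff]
  refine ⟨toLex (r, s r), ?_, ?_⟩
  · intro w hw
    obtain ⟨⟨r', c⟩, rfl⟩ := toLex.surjective w
    change permExp s p (toLex (r', c)) = permExp s 1 (toLex (r', c))
    rw [permExp_apply, permExp_apply]
    rw [Prod.Lex.toLex_lt_toLex] at hw
    rcases hw with h | ⟨h, h'⟩
    · rw [hfix r' h]; rfl
    · simp only at h h'
      subst h
      rw [if_neg ((h'.trans (hs hgt)).ne'), if_neg]
      exact h'.ne'
  · change permExp s p (toLex (r, s r)) < permExp s 1 (toLex (r, s r))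
    rw [permExp_apply, permExp_apply, if_neg, if_pos (show s ((1 : Equiv.Perm (Fin n)).symm r) = s r from rfl)]
    · exact Nat.zero_lt_one
    · exact fun h => hr (hs.injective h)

theorem minor_eq (σ : Finset (Fin m)) (h : σ.card = n) :
    minor k σ h = ∑ p : Equiv.Perm (Fin n),
      monomial (permExp (σ.orderEmbOfFin h) p) (((Equiv.Perm.sign p : ℤˣ) : ℤ) : k) := by
  rw [minor, Matrix.det_apply']
  refine Finset.sum_congr rfl fun p _ => ?_
  simp only [Matrix.submatrix_apply, genericMatrix, Matrix.of_apply, id, X, permExp]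
  rw [← monomial_sum_one, ← map_intCast (C : k →+* Ring n m k), C_mul_monomial, mul_one]

/-- The initial term of a maximal minor is its diagonal term. -/
theorem initialMinor_eq (σ : Finset (Fin m)) (h : σ.card = n) :
    initialMinor k σ h = ∏ i, X (toLex (i, σ.orderEmbOfFin h i)) := by
  set s := σ.orderEmbOfFin h with hsdef
  have hs : StrictMono s := s.strictMono
  have hc : (minor k σ h).coeff (permExp s 1) = 1 := by
    rw [minor_eq, coeff_sum, Finset.sum_eq_single 1]
    · simp [← hsdef]
    · intro p _ hp
      rw [coeff_monomial, if_neg]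
      intro he
      exact (permExp_lt hs hp).ne (congrArg toLex he)
    · simp
  have hdeg : (MonomialOrder.lex (σ := Vars n m)).degree (minor k σ h) = permExp s 1 := by
    apply (MonomialOrder.lex (σ := Vars n m)).toSyn.injective
    apply le_antisymm
    · rw [MonomialOrder.degree_le_iff]
      intro c hcs
      rw [mem_support_iff, minor_eq, coeff_sum] at hcs
      obtain ⟨p, -, hp⟩ := Finset.exists_ne_zero_of_sum_ne_zero hcs
      rw [coeff_monomial] at hp
      have hpc : permExp s p = c := by
        by_contra hne
        exact hp (if_neg hne)
      rw [MonomialOrder.lex_le_iff, ← hpc]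
      by_cases hp1 : p = 1
      · rw [hp1]
      · exact (permExp_lt hs hp1).le
    · apply MonomialOrder.le_degree
      rw [mem_support_iff, hc]
      exact one_ne_zero
  rw [initialMinor, MonomialOrder.leadingTerm, MonomialOrder.leadingCoeff, hdeg, hc, permExp,
    monomial_sum_one]
  rfl

/-- The variable in row `r`, or `0` if there is no such row. -/
def xNat (r : ℕ) (a : Fin m) : Ring n m k := if h : r < n then X (toLex (⟨r, h⟩, a)) else 0

theorem pos_orderEmbOfFin (σ : Finset (Fin m)) (h : σ.card = n) (i : Fin n) :
    pos σ (σ.orderEmbOfFin h i) = i := by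
  have : σ.filter (· < σ.orderEmbOfFin h i) =
      (Finset.Iio i).map (σ.orderEmbOfFin h).toEmbedding := by
    ext a
    simp only [Finset.mem_filter, Finset.mem_map, Finset.mem_Iio, RelEmbedding.coe_toEmbedding]
    constructor
    · rintro ⟨ha, hlt⟩
      have : a ∈ Set.range (σ.orderEmbOfFin h) := by
        rw [Finset.range_orderEmbOfFin]; exact ha
      obtain ⟨j, rfl⟩ := this
      exact ⟨j, by simpa using hlt, rfl⟩
    · rintro ⟨j, hj, rfl⟩
      exact ⟨Finset.orderEmbOfFin_mem _ _ _, by simpa using hj⟩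
  rw [pos, this, Finset.card_map, Fin.card_Iio]

theorem initialMinor_eq_prod (σ : Finset (Fin m)) (h : σ.card = n) :
    initialMinor k σ h = ∏ a ∈ σ, xNat (pos σ a) a := by
  have hσ : σ = Finset.univ.map (σ.orderEmbOfFin h).toEmbedding := by
    apply Finset.coe_injective
    simp
  have : ∏ a ∈ σ, (xNat (pos σ a) a : Ring n m k) =
      ∏ a ∈ Finset.univ.map (σ.orderEmbOfFin h).toEmbedding, xNat (pos σ a) a := by
    rw [← hσ]
  rw [initialMinor_eq, this, Finset.prod_map]
  refine Finset.prod_congr rfl fun i _ => ?_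
  simp only [RelEmbedding.coe_toEmbedding, pos_orderEmbOfFin, xNat, i.2, dif_pos]

theorem mul_initialMinor {σ : Finset (Fin m)} {i : Fin n} {a : Fin m} (ha : a ∈ σ)
    (hp : pos σ a = i ∨ pos σ a = i + 1) (h : (σ.erase a).card = n) :
    X (toLex (i, a)) * initialMinor k (σ.erase a) h =
      ∏ b ∈ σ, xNat (if pos σ b ≤ i then pos σ b else pos σ b - 1) b := by
  rw [initialMinor_eq_prod, ← Finset.mul_prod_erase σ _ ha]
  congr 1
  · have : (if pos σ a ≤ i then pos σ a else pos σ a - 1) = i := by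
      split_ifs <;> omega
    rw [this, xNat, dif_pos i.2]
  · refine Finset.prod_congr rfl fun b hb => ?_
    rw [Finset.mem_erase] at hb
    have p1 := pos_erase ha b
    congr 1
    rcases lt_or_gt_of_ne hb.1 with hlt | hlt
    · have := pos_lt hb.2 hlt
      simp only [hlt.not_gt, if_false] at p1
      rw [if_pos] <;> omega
    · have := pos_lt ha hlt
      simp only [hlt, if_true] at p1
      split_ifs <;> omega

theorem sum_initialMinor (b : Idx n Δ 1) :
    ∑ q ∈ (indexSet b.1.1 b.1.2).attach, ((-1) ^ pos b.1.2 q.1.2 * X (toLex q.1) : Ring n m k) *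
      initialMinor k (b.remove q.1 q.2).1.2 (card_eq _) = 0 := by
  obtain ⟨⟨α, σ⟩, hσ, hcard, hα⟩ := b
  simp only at hcard hα
  have hex : ∃ i, 0 < α i := by
    by_contra! h
    have : ∑ l, α l = 0 := Finset.sum_eq_zero fun l _ => Nat.le_zero.1 (h l)
    omega
  obtain ⟨i, hi⟩ := hex
  have hαi : α = Pi.single i 1 := by
    have h1 := Finset.add_sum_erase Finset.univ α (Finset.mem_univ i)
    have h0 : ∑ l ∈ Finset.univ.erase i, α l = 0 := by omega
    rw [Finset.sum_eq_zero_iff] at h0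
    ext l
    by_cases hl : l = i
    · subst hl; simp; omega
    · simp [hl, h0 l (by simp [hl])]
  have hlo : ∑ l ∈ Finset.Iio i, α l = 0 := by
    rw [hαi]; simp [Pi.single_apply]
  have hhi : ∑ l ∈ Finset.Iic i, α l = 1 := by
    rw [hαi]; simp [Pi.single_apply]
  have hmem : ∀ q, q ∈ indexSet α σ ↔
      q.1 = i ∧ q.2 ∈ σ ∧ (pos σ q.2 = i ∨ pos σ q.2 = i + 1) := by
    rintro ⟨j, a⟩
    simp only [indexSet, Finset.mem_filter, Finset.mem_univ, true_and]
    constructor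
    · rintro ⟨hj, ha, h1, h2⟩
      have hji : j = i := by
        by_contra hne
        rw [hαi] at hj
        simp [hne] at hj
      subst hji
      rw [hlo] at h1
      rw [hhi] at h2
      exact ⟨rfl, ha, by omega⟩
    · rintro ⟨rfl, ha, h⟩
      rw [hlo, hhi]
      exact ⟨hi, ha, by omega, by omega⟩
  set s := σ.orderEmbOfFin hcard with hs
  have hset : indexSet α σ = {(i, s i.castSucc), (i, s i.succ)} := by
    ext ⟨j, a⟩
    rw [hmem]
    simp only [Finset.mem_insert, Finset.mem_singleton, Prod.mk.injEq]
    constructor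
    · rintro ⟨rfl, ha, h⟩
      have : a ∈ Set.range s := by
        rw [hs, Finset.range_orderEmbOfFin]; exact ha
      obtain ⟨t, rfl⟩ := this
      rw [hs, pos_orderEmbOfFin] at h
      rcases h with h | h
      · left; refine ⟨rfl, congrArg s (Fin.ext ?_)⟩; simpa using h
      · right; refine ⟨rfl, congrArg s (Fin.ext ?_)⟩; simpa using h
    · rintro (⟨rfl, rfl⟩ | ⟨rfl, rfl⟩)
      · refine ⟨rfl, Finset.orderEmbOfFin_mem _ _ _, Or.inl ?_⟩
        rw [hs, pos_orderEmbOfFin]; simp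
      · refine ⟨rfl, Finset.orderEmbOfFin_mem _ _ _, Or.inr ?_⟩
        rw [hs, pos_orderEmbOfFin]; simp
  have hterm : ∀ q : {x // x ∈ indexSet α σ},
      ((-1) ^ pos σ q.1.2 * X (toLex q.1) : Ring n m k) *
        initialMinor k (Idx.remove (Δ := Δ) (i := 0) ⟨(α, σ), hσ, hcard, hα⟩ q.1 q.2).1.2
          (card_eq _) =
      (-1) ^ pos σ q.1.2 * ∏ b ∈ σ, xNat (if pos σ b ≤ i then pos σ b else pos σ b - 1) b := by
    rintro ⟨⟨j, a⟩, hq⟩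
    obtain ⟨h1, h2, h3⟩ := (hmem _).1 hq
    simp only at h1 h2 h3
    subst h1
    rw [mul_assoc]
    congr 1
    exact mul_initialMinor h2 h3 _
  rw [Finset.sum_congr rfl fun q _ => hterm q]
  rw [Finset.sum_attach (indexSet α σ) (fun q => (-1) ^ pos σ q.2 *
    ∏ b ∈ σ, (xNat (if pos σ b ≤ i then pos σ b else pos σ b - 1) b : Ring n m k)), hset,
    Finset.sum_pair]
  · simp only [hs, pos_orderEmbOfFin, Fin.val_castSucc, Fin.val_succ, pow_succ]
    ring
  · simp [Fin.ext_iff]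

theorem diff_diff_zero :
    (diff 0 ∘ₗ diff 1 : (Basis n Δ 2 →₀ Ring n m k) →ₗ[Ring n m k] _) = 0 := by
  refine Finsupp.lhom_ext fun b r => ?_
  rw [LinearMap.comp_apply, diff_single, map_smul]
  have : diff 0 (dBasis 1 b) = (0 : Basis n Δ 0 →₀ Ring n m k) := by
    refine (map_sum (diff 0) _ _).trans ?_
    refine Eq.trans (b := Finsupp.single () (∑ q ∈ (indexSet b.1.1 b.1.2).attach,
      ((-1) ^ pos b.1.2 q.1.2 * X (toLex q.1) : Ring n m k) *
        initialMinor k (Idx.remove (i := 0) b q.1 q.2).1.2 (card_eq _))) ?_ ?_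
    · rw [Finsupp.single_finsetSum]
      refine Finset.sum_congr rfl fun q _ => ?_
      refine (diff_single 0 _ _).trans ?_
      exact Finsupp.smul_single _ _ _
    · exact (congrArg (Finsupp.single ()) (sum_initialMinor b)).trans (Finsupp.single_zero _)
  rw [this, smul_zero, LinearMap.zero_apply]

theorem finite_Idx (i : ℕ) : Finite (Idx n Δ i) := by
  have : Finite {α : Fin n → ℕ // ∑ l, α l = i} := by
    refine Set.Finite.subset (Set.finite_Iic (fun _ : Fin n => i)) fun α hα l => ?_
    have hα' : ∑ l, α l = i := hα
    rw [← hα']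
    exact Finset.single_le_sum (f := α) (fun _ _ => Nat.zero_le _) (Finset.mem_univ l)
  refine Finite.of_injective (β := {α : Fin n → ℕ // ∑ l, α l = i} × Finset (Fin m))
    (fun b => (⟨b.1.1, b.2.2.2⟩, b.1.2)) ?_
  intro b c h
  simp only [Prod.mk.injEq, Subtype.mk.injEq] at h
  exact Subtype.ext (Prod.ext h.1 h.2)

theorem homogeneous_dIdx {i : ℕ} (b : Idx n Δ (i + 1)) (c : Idx n Δ i) (s : Vars n m →₀ ℕ)
    (h : ((dIdx b : Idx n Δ i →₀ Ring n m k) c).coeff s ≠ 0) : s.degree = 1 := by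
  have hh : ((dIdx b : Idx n Δ i →₀ Ring n m k) c).IsHomogeneous 1 := by
    rw [dIdx, Finsupp.finsetSum_apply]
    refine IsHomogeneous.sum _ _ _ fun q _ => ?_
    rw [Finsupp.single_apply]
    split_ifs
    · refine IsHomogeneous.mul (m := 0) (n := 1) ?_ (isHomogeneous_X _ _)
      have : ((-1) ^ pos b.1.2 q.1.2 : Ring n m k) = C ((-1) ^ pos b.1.2 q.1.2) := by simp
      rw [this]
      exact isHomogeneous_C _ _
    · exact isHomogeneous_zero _ _ _
  rw [Finsupp.degree_eq_weight_one]
  exact hh h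

theorem homogeneous_initialMinor (σ : Finset (Fin m)) (hσ : σ.card = n) (s : Vars n m →₀ ℕ)
    (h : (initialMinor k σ hσ).coeff s ≠ 0) : s.degree = n := by
  have hh : (initialMinor k σ hσ).IsHomogeneous n := by
    rw [initialMinor_eq]
    have := IsHomogeneous.prod Finset.univ
      (fun i => (X (toLex (i, σ.orderEmbOfFin hσ i)) : Ring n m k)) (fun _ => 1)
      fun i _ => isHomogeneous_X _ _
    simpa using this
  rw [Finsupp.degree_eq_weight_one]
  exact hh h

variable (n Δ k) in
/-- The generalized sparse Eagon-Northcott complex of a simplicial complex `Δ` on `m` vertices and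
the generic `n × m` matrix over `k`. -/
def sparseENComplex : GradedFreeComplex (Vars n m) k where
  B := Basis n Δ
  finite_B
    | 0 => inferInstanceAs (Finite Unit)
    | i + 1 => finite_Idx i
  deg := degree n Δ
  d := diff
  homogeneous_d
    | 0, b, c, s, h => by
      rw [diff_single, one_smul] at h
      have : s.degree = n := by
        refine homogeneous_initialMinor (k := k) b.1.2 (card_eq b) s ?_
        have hc : c = () := rfl
        rw [hc] at h
        simpa [dBasis] using h
      simp [degree, this]
    | i + 1, b, c, s, h => by
      rw [diff_single, one_smul] at h
      have : s.degree = 1 := homogeneous_dIdx (k := k) b c s h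
      simp only [degree, this]
      omega
  d_comp_d
    | 0 => diff_diff_zero
    | i + 1 => diff_diff_succ i

end SparseEN

end

/-!
A basis element `g^{*(α)} ⊗ f_σ` of `𝒞` is a staircase in `[n] × [m]`: row `l` holds the `α_l + 1`
elements of `σ` following those of the earlier rows. The differential removes a cell `q` from a row
with at least two cells, with coefficient `± x_q`, and `d₁` sends a staircase to the product of its
variables.

Comparing coefficients of monomials, a cycle with constant coefficients vanishes, and a cycle with
linear coefficients is given by scalars `c P q` (the coefficient of `x_q` at the staircase `P`).
The cycle equations force `P ∪ {q}` to be a staircase whenever `c P q ≠ 0`; its columns form a face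
because removing either of two consecutive columns from them leaves a face and `Δ` has no large
1-nonface. They also say that, up to sign, `c P q` depends only on `P ∪ {q}`, so the cycle is a
boundary.

Any complex of free modules generated in the right degrees with these two vanishing properties is a
linear strand: the syzygies that it does not generate have higher degrees, so adding minimal
generators of these degrees, one homological degree at a time, completes it to a minimal resolution
of the image of `d₁`.
-/

noncomputable section

namespace GradedFree

/-! ### Homogeneous vectors -/

section HomogeneousVector

variable {σ R B B' : Type*} [CommSemiring R] {deg : B → ℕ} {deg' : B' → ℕ} {e : ℕ}
  {v w : B →₀ MvPolynomial σ R} {c : B}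

/-- The vector `v` is homogeneous of degree `e` in the graded free module on `B` in which the basis
vector `b` has degree `deg b`. -/
def IsHomogeneousVector (deg : B → ℕ) (e : ℕ) (v : B →₀ MvPolynomial σ R) : Prop :=
  ∀ c s, coeff s (v c) ≠ 0 → s.degree + deg c = e

theorem IsHomogeneousVector.apply_eq_zero (h : IsHomogeneousVector deg e v) (hc : e < deg c) :
    v c = 0 := by
  ext s
  by_contra hs
  have := h c s hs
  omega

theorem IsHomogeneousVector.apply_eq_C (h : IsHomogeneousVector deg (deg c) v) :
    v c = C (constantCoeff (v c)) := by
  classical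
  ext s
  rw [coeff_C]
  split_ifs with hs
  · rw [← hs, constantCoeff_eq]
  · by_contra h0
    exact hs ((Finsupp.degree_eq_zero_iff s).1 (Nat.add_eq_right.1 (h c s h0))).symm

theorem IsHomogeneousVector.apply_eq_zero_of_constantCoeff_eq_zero
    (h : IsHomogeneousVector deg e v) (hc : e ≤ deg c) (h0 : constantCoeff (v c) = 0) :
    v c = 0 := by
  rcases hc.eq_or_lt with rfl | hc
  · rw [h.apply_eq_C, h0, map_zero]
  · exact h.apply_eq_zero hc

theorem isHomogeneousVector_single (deg : B → ℕ) (b : B) :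
    IsHomogeneousVector deg (deg b) (Finsupp.single b 1 : B →₀ MvPolynomial σ R) := by
  classical
  intro c s hs
  rw [Finsupp.single_apply] at hs
  split_ifs at hs with hbc
  · rw [coeff_one] at hs
    rw [← not_not.1 fun h => hs (if_neg h), map_zero, zero_add, hbc]
  · exact absurd (coeff_zero s) hs

theorem IsHomogeneousVector.smul (h : IsHomogeneousVector deg e v) {p : MvPolynomial σ R} {d : ℕ}
    (hp : p.IsHomogeneous d) : IsHomogeneousVector deg (d + e) (p • v) := by
  classical
  intro c s hs
  rw [Finsupp.smul_apply, smul_eq_mul, coeff_mul] at hs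
  obtain ⟨⟨s₁, s₂⟩, hmem, hne⟩ := Finset.exists_ne_zero_of_sum_ne_zero hs
  rw [← Finset.HasAntidiagonal.mem_antidiagonal.1 hmem, map_add, add_assoc,
    h c s₂ (right_ne_zero_of_mul hne), Finsupp.degree_eq_weight_one]
  exact congrArg (· + e) (hp (left_ne_zero_of_mul hne))

/-- The homogeneous component of degree `e` in the graded free module on `B` in which the basis
vector `b` has degree `deg b`. -/
def component (deg : B → ℕ) (e : ℕ) :
    (B →₀ MvPolynomial σ R) →+ (B →₀ MvPolynomial σ R) where
  toFun v := Finsupp.onFinset v.support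
    (fun c => if deg c ≤ e then homogeneousComponent (e - deg c) (v c) else 0) fun c hc =>
      Finsupp.mem_support_iff.2 fun h => hc (by rw [h, map_zero, ite_self])
  map_zero' := by
    ext c
    simp
  map_add' v w := by
    refine Finsupp.ext fun c => ?_
    simp only [Finsupp.onFinset_apply, Finsupp.add_apply, map_add]
    split_ifs
    · rfl
    · rw [add_zero]

theorem coeff_component (deg : B → ℕ) (e : ℕ) (v : B →₀ MvPolynomial σ R) (c : B) (s : σ →₀ ℕ) :
    coeff s (component deg e v c) = if s.degree + deg c = e then coeff s (v c) else 0 := by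
  change coeff s (if deg c ≤ e then homogeneousComponent (e - deg c) (v c) else 0) = _
  by_cases h : deg c ≤ e
  · rw [if_pos h, coeff_homogeneousComponent]
    exact if_congr (by omega) rfl rfl
  · rw [if_neg h, coeff_zero, if_neg (by omega)]

theorem constantCoeff_component (deg : B → ℕ) (v : B →₀ MvPolynomial σ R) (c : B) :
    constantCoeff (component deg (deg c) v c) = constantCoeff (v c) := by
  rw [constantCoeff_eq]
  exact (coeff_component _ _ _ _ _).trans (if_pos (by rw [map_zero, zero_add]))

theorem isHomogeneousVector_component (deg : B → ℕ) (e : ℕ) (v : B →₀ MvPolynomial σ R) :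
    IsHomogeneousVector deg e (component deg e v) := by
  intro c s h
  by_contra hne
  exact h ((coeff_component deg e v c s).trans (if_neg hne))

theorem IsHomogeneousVector.component_eq (h : IsHomogeneousVector deg e v) (d : ℕ) :
    component deg d v = if e = d then v else 0 := by
  refine Finsupp.ext fun c => MvPolynomial.ext _ _ fun s => ?_
  rw [coeff_component]
  by_cases hs : coeff s (v c) = 0
  · split_ifs <;> simp only [hs, Finsupp.zero_apply, coeff_zero]
  · rw [h c s hs]
    split_ifs <;> rfl

theorem isHomogeneousVector_iff_component_eq :
    IsHomogeneousVector deg e v ↔ component deg e v = v :=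
  ⟨fun h => (h.component_eq e).trans (if_pos rfl),
    fun h => h ▸ isHomogeneousVector_component deg e v⟩

theorem exists_eq_sum_component (deg : B → ℕ) (v : B →₀ MvPolynomial σ R) :
    ∃ M, v = ∑ e ∈ Finset.range M, component deg e v := by
  refine ⟨v.support.sup (fun c => (v c).totalDegree + deg c) + 1, ?_⟩
  refine Finsupp.ext fun c => MvPolynomial.ext _ _ fun s => ?_
  rw [Finsupp.finsetSum_apply, coeff_sum,
    Finset.sum_congr rfl fun e _ => coeff_component deg e v c s, Finset.sum_ite_eq]
  split_ifs with h
  · rfl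
  · by_contra hs
    have hc : c ∈ v.support := Finsupp.mem_support_iff.2 fun h0 => hs (by rw [h0, coeff_zero])
    refine h (Finset.mem_range.2 (Nat.lt_succ_of_le (le_trans ?_ (Finset.le_sup hc))))
    exact Nat.add_le_add_right (le_totalDegree (mem_support_iff.2 hs)) _

/-- The linear map `f` between graded free modules, whose basis vectors have the degrees `deg'` and
`deg`, is homogeneous of degree `0`. -/
def IsHomogeneousMap (deg' : B' → ℕ) (deg : B → ℕ)
    (f : (B' →₀ MvPolynomial σ R) →ₗ[MvPolynomial σ R] (B →₀ MvPolynomial σ R)) : Prop :=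
  ∀ b, IsHomogeneousVector deg (deg' b) (f (Finsupp.single b 1))

variable {f : (B' →₀ MvPolynomial σ R) →ₗ[MvPolynomial σ R] (B →₀ MvPolynomial σ R)}

theorem IsHomogeneousMap.component_map (hf : IsHomogeneousMap deg' deg f) (d : ℕ)
    (v : B' →₀ MvPolynomial σ R) : component deg d (f v) = f (component deg' d v) := by
  induction v using Finsupp.induction_linear with
  | zero => simp only [map_zero]
  | add v w hv hw => simp only [map_add, hv, hw]
  | single b p =>
    induction p using MvPolynomial.induction_on' with
    | add p q hp hq => simp only [Finsupp.single_add, map_add, hp, hq]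
    | monomial u r =>
      have hu : (monomial u r).IsHomogeneous u.degree := isHomogeneous_monomial r rfl
      rw [← mul_one (monomial u r), ← smul_eq_mul, ← Finsupp.smul_single, map_smul,
        ((hf b).smul hu).component_eq,
        ((isHomogeneousVector_single deg' b).smul hu).component_eq]
      split_ifs
      · rw [map_smul]
      · rw [map_zero]

/-- The submodule `K` of a graded free module, whose basis vectors have the degrees `deg`, is
graded. -/
def IsGradedSubmodule (deg : B → ℕ)
    (K : Submodule (MvPolynomial σ R) (B →₀ MvPolynomial σ R)) : Prop :=
  ∀ v ∈ K, ∀ e, component deg e v ∈ K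

theorem IsHomogeneousMap.isGradedSubmodule_ker (hf : IsHomogeneousMap deg' deg f) :
    IsGradedSubmodule deg' (LinearMap.ker f) := fun v hv e => by
  rw [LinearMap.mem_ker, ← hf.component_map, LinearMap.mem_ker.1 hv, map_zero]

theorem IsHomogeneousMap.isGradedSubmodule_range (hf : IsHomogeneousMap deg' deg f) :
    IsGradedSubmodule deg (LinearMap.range f) := by
  rintro _ ⟨v, rfl⟩ e
  exact ⟨component deg' e v, (hf.component_map e v).symm⟩

end HomogeneousVector

section SubmoduleGrading

variable {σ R B : Type*} [CommRing R] {deg : B → ℕ}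
  {K : Submodule (MvPolynomial σ R) (B →₀ MvPolynomial σ R)}

/-- The grading that a submodule inherits from a graded free module. -/
def submoduleGrading (deg : B → ℕ) (K : Submodule (MvPolynomial σ R) (B →₀ MvPolynomial σ R))
    (e : ℕ) : AddSubgroup K where
  carrier := {x | IsHomogeneousVector deg e x.1}
  zero_mem' := isHomogeneousVector_iff_component_eq.2 (map_zero _)
  add_mem' hx hy := isHomogeneousVector_iff_component_eq.2 <| by
    rw [Submodule.coe_add, map_add, isHomogeneousVector_iff_component_eq.1 hx,
      isHomogeneousVector_iff_component_eq.1 hy]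
  neg_mem' hx := isHomogeneousVector_iff_component_eq.2 <| by
    rw [Submodule.coe_neg, map_neg, isHomogeneousVector_iff_component_eq.1 hx]

theorem mem_submoduleGrading {e : ℕ} {x : K} :
    x ∈ submoduleGrading deg K e ↔ IsHomogeneousVector deg e x.1 := Iff.rfl

theorem component_coeAddMonoidHom (x : DirectSum ℕ fun e => submoduleGrading deg K e) (e : ℕ) :
    component deg e (DirectSum.coeAddMonoidHom (submoduleGrading deg K) x).1 = (x e).1.1 := by
  induction x using DirectSum.induction_on with
  | zero => simp only [map_zero, Submodule.coe_zero, DirectSum.zero_apply, AddSubgroup.coe_zero]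
  | of d y =>
    rw [DirectSum.coeAddMonoidHom_of, (mem_submoduleGrading.1 y.2).component_eq]
    split_ifs with h
    · subst h
      rw [DirectSum.of_eq_same]
    · rw [DirectSum.of_eq_of_ne _ _ _ (Ne.symm h)]
      rfl
  | add x y hx hy =>
    rw [map_add, Submodule.coe_add, map_add, hx, hy]
    rfl

theorem IsGradedSubmodule.isGradedModule {V B : Type} {k : Type u} [Field k] {deg : B → ℕ}
    {K : Submodule (MvPolynomial V k) (B →₀ MvPolynomial V k)} (hK : IsGradedSubmodule deg K) :
    IsGradedModule (V := V) (k := k) (submoduleGrading deg K) where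
  isInternal := by
    constructor
    · rw [injective_iff_map_eq_zero]
      refine fun x hx => DFinsupp.ext fun e => Subtype.ext (Subtype.ext ?_)
      rw [← component_coeAddMonoidHom, hx, Submodule.coe_zero, map_zero]
      rfl
    · intro x
      obtain ⟨M, hM⟩ := exists_eq_sum_component deg x.1
      refine ⟨∑ e ∈ Finset.range M, DirectSum.of (fun e => submoduleGrading deg K e) e
        ⟨⟨_, hK x.1 x.2 e⟩, isHomogeneousVector_component deg e x.1⟩, Subtype.ext ?_⟩
      simp only [map_sum, DirectSum.coeAddMonoidHom_of, AddSubmonoidClass.coe_finsetSum]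
      exact hM.symm
  smul_mem _ _ _ _ hr hx := (mem_submoduleGrading.1 hx).smul hr

end SubmoduleGrading

/-! ### Direct sum decompositions -/

section Sum

variable {σ R B E : Type*} [CommSemiring R]

variable (σ R B E) in
/-- The inclusion of a free module as the first summand of a larger one. -/
abbrev inlMap : (B →₀ MvPolynomial σ R) →ₗ[MvPolynomial σ R] (B ⊕ E →₀ MvPolynomial σ R) :=
  Finsupp.lmapDomain (MvPolynomial σ R) (MvPolynomial σ R) Sum.inl

variable (σ R B E) in
/-- The projection of a free module onto its first summand. -/
abbrev fstMap : (B ⊕ E →₀ MvPolynomial σ R) →ₗ[MvPolynomial σ R] (B →₀ MvPolynomial σ R) :=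
  Finsupp.lcomapDomain Sum.inl Sum.inl_injective

theorem inlMap_inl (v : B →₀ MvPolynomial σ R) (b : B) : inlMap σ R B E v (Sum.inl b) = v b :=
  Finsupp.mapDomain_apply Sum.inl_injective _ _

theorem inlMap_inr (v : B →₀ MvPolynomial σ R) (j : E) : inlMap σ R B E v (Sum.inr j) = 0 :=
  Finsupp.mapDomain_of_notMem_range _ _ (by simp)

theorem inlMap_single (b : B) (p : MvPolynomial σ R) :
    inlMap σ R B E (Finsupp.single b p) = Finsupp.single (Sum.inl b) p :=
  Finsupp.mapDomain_single

theorem fstMap_inlMap (v : B →₀ MvPolynomial σ R) : fstMap σ R B E (inlMap σ R B E v) = v :=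
  Finsupp.ext fun b => inlMap_inl v b

theorem fstMap_single_inl (b : B) (p : MvPolynomial σ R) :
    fstMap σ R B E (Finsupp.single (Sum.inl b) p) = Finsupp.single b p := by
  rw [← inlMap_single, fstMap_inlMap]

theorem inlMap_injective : Function.Injective (inlMap σ R B E) :=
  Function.LeftInverse.injective fstMap_inlMap

theorem inlMap_fstMap {v : B ⊕ E →₀ MvPolynomial σ R} (h : ∀ j, v (Sum.inr j) = 0) :
    inlMap σ R B E (fstMap σ R B E v) = v := by
  refine Finsupp.ext fun b => ?_
  cases b with
  | inl b => exact inlMap_inl _ b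
  | inr j => rw [inlMap_inr, h]

theorem linearCombination_elim_inlMap {M : Type*} [AddCommMonoid M] [Module (MvPolynomial σ R) M]
    (g : B → M) (g' : E → M) (v : B →₀ MvPolynomial σ R) :
    Finsupp.linearCombination (MvPolynomial σ R) (Sum.elim g g') (inlMap σ R B E v) =
      Finsupp.linearCombination (MvPolynomial σ R) g v :=
  Finsupp.linearCombination_mapDomain _ _ _

theorem IsHomogeneousVector.inlMap {deg : B → ℕ} {e : ℕ} {v : B →₀ MvPolynomial σ R}
    (h : IsHomogeneousVector deg e v) (deg' : E → ℕ) :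
    IsHomogeneousVector (Sum.elim deg deg') e (GradedFree.inlMap σ R B E v) := by
  rintro (b | j) s hs
  · rw [inlMap_inl] at hs
    exact h b s hs
  · rw [inlMap_inr] at hs
    exact absurd (coeff_zero _) hs

theorem range_inlMap {deg : B → ℕ} {deg' : E → ℕ} {e : ℕ} (h : ∀ b, deg b = e)
    (h' : ∀ j, deg' j ≠ e) : LinearMap.range (inlMap σ R B E) =
      Submodule.span (MvPolynomial σ R)
        {v | ∃ b, Sum.elim deg deg' b = e ∧ v = Finsupp.single b 1} := by
  rw [Finsupp.range_lmapDomain]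
  congr 1
  ext v
  constructor
  · rintro ⟨b, rfl⟩
    exact ⟨Sum.inl b, h b, rfl⟩
  · rintro ⟨b | j, hb, rfl⟩
    · exact ⟨b, rfl⟩
    · exact absurd hb (h' j)

end Sum

/-! ### Minimal generators -/

section MinimalGenerators

theorem mem_span_image_compl_of_linearCombination_eq_zero {R M ι : Type*} [Ring R]
    [AddCommGroup M] [Module R M] {g : ι → M} {a : ι →₀ R}
    (ha : Finsupp.linearCombination R g a = 0) {j : ι} (hj : IsUnit (a j)) :
    g j ∈ Submodule.span R (g '' {j}ᶜ) := by
  classical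
  rw [← Finsupp.single_add_erase j a, map_add, Finsupp.linearCombination_single] at ha
  rw [← Submodule.smul_mem_iff_of_isUnit _ hj, eq_neg_of_add_eq_zero_left ha, Submodule.neg_mem_iff]
  refine (Finsupp.mem_span_image_iff_linearCombination R).2 ⟨a.erase j, ?_, rfl⟩
  simp [Finsupp.mem_supported]

variable {σ B : Type*} {deg : B → ℕ} {e₀ : ℕ}

/-- The homogeneous vectors `g j`, of degrees `degs j` larger than `e₀`, generate `K` together with
`S`. -/
structure IsHomogeneousCompletion {R : Type*} [CommSemiring R] (deg : B → ℕ)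
    (K : Submodule (MvPolynomial σ R) (B →₀ MvPolynomial σ R)) (S : Set (B →₀ MvPolynomial σ R))
    (e₀ : ℕ) {ι : Type*} (g : ι → B →₀ MvPolynomial σ R) (degs : ι → ℕ) : Prop where
  lt_degs : ∀ j, e₀ < degs j
  isHomogeneousVector : ∀ j, IsHomogeneousVector deg (degs j) (g j)
  span_union_eq : Submodule.span (MvPolynomial σ R) (S ∪ Set.range g) = K

section

variable {R : Type*} [CommSemiring R]
  {K : Submodule (MvPolynomial σ R) (B →₀ MvPolynomial σ R)} {S : Set (B →₀ MvPolynomial σ R)}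

theorem IsGradedSubmodule.exists_isHomogeneousCompletion (hK : IsGradedSubmodule deg K)
    (hfg : K.FG) (hSK : S ⊆ K) (hS : ∀ e ≤ e₀, ∀ v ∈ K, IsHomogeneousVector deg e v →
      v ∈ Submodule.span (MvPolynomial σ R) S) :
    ∃ (r : ℕ) (g : Fin r → B →₀ MvPolynomial σ R) (degs : Fin r → ℕ),
      IsHomogeneousCompletion deg K S e₀ g degs := by
  obtain ⟨r, s, hs⟩ := Submodule.fg_iff_exists_fin_generating_family.1 hfg
  have hsK (l : Fin r) : s l ∈ K := hs ▸ Submodule.subset_span ⟨l, rfl⟩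
  choose M hM using fun l => exists_eq_sum_component deg (s l)
  let I := Σ l, {e // e ∈ (Finset.range (M l)).filter (e₀ < ·)}
  let q : I ≃ Fin (Fintype.card I) := Fintype.equivFin I
  refine ⟨Fintype.card I, fun j => component deg (q.symm j).2 (s (q.symm j).1),
    fun j => (q.symm j).2, fun j => (Finset.mem_filter.1 (q.symm j).2.2).2,
    fun j => isHomogeneousVector_component _ _ _, le_antisymm ?_ ?_⟩
  · refine Submodule.span_le.2 (Set.union_subset hSK ?_)
    rintro _ ⟨j, rfl⟩
    exact hK _ (hsK _) _
  · rw [← hs, Submodule.span_le]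
    rintro _ ⟨l, rfl⟩
    rw [hM l]
    refine Submodule.sum_mem _ fun e he => ?_
    rcases le_or_gt e e₀ with h | h
    · exact Submodule.span_mono Set.subset_union_left
        (hS e h _ (hK _ (hsK l) e) (isHomogeneousVector_component _ _ _))
    · exact Submodule.subset_span (Or.inr ⟨q ⟨l, e, Finset.mem_filter.2 ⟨he, h⟩⟩,
        congrArg (fun p : I => component deg p.2 (s p.1)) (q.symm_apply_apply _)⟩)

theorem IsHomogeneousCompletion.comp_succAbove {r : ℕ} {g : Fin (r + 1) → B →₀ MvPolynomial σ R}
    {degs : Fin (r + 1) → ℕ} (h : IsHomogeneousCompletion deg K S e₀ g degs) {j : Fin (r + 1)}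
    (hj : g j ∈ Submodule.span (MvPolynomial σ R) (S ∪ g '' {j}ᶜ)) :
    IsHomogeneousCompletion deg K S e₀ (g ∘ j.succAbove) (degs ∘ j.succAbove) where
  lt_degs l := h.lt_degs _
  isHomogeneousVector l := h.isHomogeneousVector _
  span_union_eq := by
    rw [Set.range_comp, Fin.range_succAbove, ← Submodule.span_insert_eq_span hj,
      ← Set.union_insert, ← Set.image_insert_eq, Set.insert_eq, Set.union_compl_self,
      Set.image_univ, h.span_union_eq]

theorem exists_irredundant_isHomogeneousCompletion
    (h : ∃ (r : ℕ) (g : Fin r → B →₀ MvPolynomial σ R) (degs : Fin r → ℕ),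
      IsHomogeneousCompletion deg K S e₀ g degs) :
    ∃ (r : ℕ) (g : Fin r → B →₀ MvPolynomial σ R) (degs : Fin r → ℕ),
      IsHomogeneousCompletion deg K S e₀ g degs ∧
        ∀ j, g j ∉ Submodule.span (MvPolynomial σ R) (S ∪ g '' {j}ᶜ) := by
  classical
  obtain ⟨g, degs, hg⟩ := Nat.find_spec h
  have hmin (r : ℕ) (hr : r < Nat.find h) := Nat.find_min h hr
  generalize Nat.find h = r at g degs hmin
  refine ⟨r, g, degs, hg, fun j hj => ?_⟩
  cases r with
  | zero => exact j.elim0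
  | succ r => exact hmin r r.lt_succ_self ⟨_, _, hg.comp_succAbove hj⟩

end

section

variable {ι κ k : Type*} [Field k] {K : Submodule (MvPolynomial σ k) (B →₀ MvPolynomial σ k)}
  {g₀ : ι → B →₀ MvPolynomial σ k} {g : κ → B →₀ MvPolynomial σ k} {degs : κ → ℕ}

theorem isHomogeneousMap_linearCombination {R : Type*} [CommSemiring R]
    {g : κ → B →₀ MvPolynomial σ R} (hg : ∀ j, IsHomogeneousVector deg (degs j) (g j)) :
    IsHomogeneousMap degs deg (Finsupp.linearCombination (MvPolynomial σ R) g) := fun j => by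
  rw [Finsupp.linearCombination_single, one_smul]
  exact hg j

theorem IsHomogeneousVector.apply_eq_zero_of_notMem_span {M : Type*} [AddCommGroup M]
    [Module (MvPolynomial σ k) M] {g : κ → M} {j : κ}
    (hg : g j ∉ Submodule.span (MvPolynomial σ k) (g '' {j}ᶜ)) {a : κ →₀ MvPolynomial σ k}
    (h : IsHomogeneousVector degs (degs j) a)
    (ha : Finsupp.linearCombination (MvPolynomial σ k) g a = 0) : a j = 0 := by
  by_contra h0
  refine hg (mem_span_image_compl_of_linearCombination_eq_zero ha ?_)
  rw [h.apply_eq_C] at h0 ⊢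
  exact (IsUnit.mk0 _ fun h => h0 (by rw [h, map_zero])).map C

theorem IsHomogeneousCompletion.constantCoeff_eq_zero
    (hg : IsHomogeneousCompletion deg K (Set.range g₀) e₀ g degs)
    (hirr : ∀ j, g j ∉ Submodule.span (MvPolynomial σ k) (Set.range g₀ ∪ g '' {j}ᶜ))
    (hg₀ : ∀ i, IsHomogeneousVector deg e₀ (g₀ i))
    (hind : ∀ a, IsHomogeneousVector (fun _ => e₀) e₀ a →
      Finsupp.linearCombination (MvPolynomial σ k) g₀ a = 0 → a = 0)
    {a : ι ⊕ κ →₀ MvPolynomial σ k}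
    (ha : Finsupp.linearCombination (MvPolynomial σ k) (Sum.elim g₀ g) a = 0) (j : ι ⊕ κ) :
    constantCoeff (a j) = 0 := by
  let D : ι ⊕ κ → ℕ := Sum.elim (fun _ => e₀) degs
  have hmap : IsHomogeneousMap D deg
      (Finsupp.linearCombination (MvPolynomial σ k) (Sum.elim g₀ g)) :=
    isHomogeneousMap_linearCombination (Sum.rec hg₀ hg.isHomogeneousVector)
  have hhom : IsHomogeneousVector D (D j) (component D (D j) a) :=
    isHomogeneousVector_component _ _ _
  have hker := (hmap.component_map (D j) a).symm.trans (by rw [ha, map_zero])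
  rw [← constantCoeff_component D a j]
  generalize component D (D j) a = a' at hhom hker
  cases j with
  | inl i =>
    have h0 (l : κ) : a' (Sum.inr l) = 0 := hhom.apply_eq_zero (hg.lt_degs l)
    rw [← inlMap_fstMap h0] at hker ⊢
    have hfst : fstMap σ k ι κ a' = 0 := hind _ (fun l => hhom (Sum.inl l))
      ((linearCombination_elim_inlMap _ _ _).symm.trans hker)
    rw [hfst, map_zero, Finsupp.zero_apply, map_zero]
  | inr j =>
    have hj : Sum.elim g₀ g (Sum.inr j) ∉
        Submodule.span (MvPolynomial σ k) (Sum.elim g₀ g '' {Sum.inr j}ᶜ) := by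
      refine fun h => hirr j (Submodule.span_mono ?_ h)
      rintro _ ⟨i | l, hl, rfl⟩
      · exact Or.inl ⟨i, rfl⟩
      · exact Or.inr ⟨l, fun h => hl (congrArg Sum.inr h), rfl⟩
    rw [hhom.apply_eq_zero_of_notMem_span hj hker, map_zero]

end

end MinimalGenerators

end GradedFree

/-! ### Complexes with the homology of a linear strand -/

namespace GradedFreeComplex

variable {V : Type} {k : Type u} [Field k]

/-- The complex `C` has its generators in the degrees of a linear strand that starts in degree `n`,
and its homology vanishes in the degrees that determine a linear strand. -/
structure IsLinearlyExact (C : GradedFreeComplex V k) (n : ℕ) : Prop where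
  deg_eq : ∀ i b, C.deg (i + 1) b = n + i
  eq_zero : ∀ i, ∀ v ∈ C.piece (i + 1) (n + i), C.d i v = 0 → v = 0
  exists_eq : ∀ i, ∀ v ∈ C.piece (i + 1) (n + i + 1), C.d i v = 0 →
    ∃ w ∈ C.piece (i + 2) (n + i + 1), C.d (i + 1) w = v

theorem isHomogeneousMap_d (C : GradedFreeComplex V k) (i : ℕ) :
    GradedFree.IsHomogeneousMap (C.deg (i + 1)) (C.deg i) (C.d i) :=
  fun b c s hs => C.homogeneous_d i b c s hs

theorem subsingleton_homology (C : GradedFreeComplex V k) {i e : ℕ}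
    (h : ∀ v ∈ C.piece (i + 1) e, C.d i v = 0 → ∃ w ∈ C.piece (i + 2) e, C.d (i + 1) w = v) :
    Subsingleton (C.homology (i + 1) e) := by
  have htop : ((C.piece (i + 1 + 1) e).map (C.d (i + 1)).toAddMonoidHom).addSubgroupOf
      (C.cycles (i + 1) ⊓ C.piece (i + 1) e) = ⊤ :=
    AddSubgroup.addSubgroupOf_eq_top.2 fun v hv => h v hv.2 hv.1
  rw [homology, htop]
  exact QuotientAddGroup.subsingleton_quotient_top

end GradedFreeComplex

namespace GradedFree

section Resolution

variable {V : Type} {k : Type u} [Field k] {C : GradedFreeComplex V k} {n i : ℕ}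

/-- The module in homological degree `i` of a minimal free resolution that has the tail of `C` as
its linear strand, together with its module of syzygies `K`: besides the generators that come from
`C` there are `r` further ones, of the degrees `deg`. -/
structure Stage (C : GradedFreeComplex V k) (n i : ℕ) where
  r : ℕ
  deg : Fin r → ℕ
  K : Submodule (MvPolynomial V k) (C.B (i + 1) ⊕ Fin r →₀ MvPolynomial V k)
  lt_deg : ∀ j, n + i < deg j
  isGradedSubmodule : IsGradedSubmodule (Sum.elim (C.deg (i + 1)) deg) K
  constantCoeff_eq_zero : ∀ v ∈ K, ∀ b, constantCoeff (v b) = 0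
  inlMap_mem_iff : ∀ v : C.X (i + 1), inlMap V k _ (Fin r) v ∈ K ↔ C.d i v = 0

namespace Stage

/-- The degrees of all generators of a stage. -/
abbrev degs (s : Stage C n i) : C.B (i + 1) ⊕ Fin s.r → ℕ :=
  Sum.elim (C.deg (i + 1)) s.deg

/-- The free module of a stage. -/
abbrev X (s : Stage C n i) : Type u :=
  C.B (i + 1) ⊕ Fin s.r →₀ MvPolynomial V k

/-- The syzygies of a stage that come from the next basis of `C`. -/
def linearSyzygy (s : Stage C n i) (b : C.B (i + 2)) : s.X :=
  inlMap V k _ _ (C.d (i + 1) (Finsupp.single b 1))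

variable (s : Stage C n i)

theorem linearCombination_linearSyzygy (v : C.X (i + 2)) :
    Finsupp.linearCombination (MvPolynomial V k) s.linearSyzygy v =
      inlMap V k _ _ (C.d (i + 1) v) := by
  refine LinearMap.congr_fun (g := inlMap V k _ _ ∘ₗ C.d (i + 1)) ?_ v
  refine Finsupp.lhom_ext' fun b => LinearMap.ext_ring ?_
  exact (Finsupp.linearCombination_single _ _ _).trans (one_smul _ _)

theorem linearSyzygy_mem (b : C.B (i + 2)) : s.linearSyzygy b ∈ s.K :=
  (s.inlMap_mem_iff _).2 (LinearMap.congr_fun (C.d_comp_d i) _)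

theorem isHomogeneousVector_linearSyzygy (b : C.B (i + 2)) :
    IsHomogeneousVector s.degs (C.deg (i + 2) b) (s.linearSyzygy b) :=
  (C.isHomogeneousMap_d (i + 1) b).inlMap _

variable {s}

theorem mem_span_linearSyzygy (hC : C.IsLinearlyExact n) {e : ℕ} (he : e ≤ n + i + 1) {v : s.X}
    (hv : v ∈ s.K) (hve : IsHomogeneousVector s.degs e v) :
    v ∈ Submodule.span (MvPolynomial V k) (Set.range s.linearSyzygy) := by
  have hinr (j : Fin s.r) : v (Sum.inr j) = 0 :=
    hve.apply_eq_zero_of_constantCoeff_eq_zero (he.trans (s.lt_deg j))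
      (s.constantCoeff_eq_zero v hv _)
  rcases he.eq_or_lt with rfl | he
  · have hfst := inlMap_fstMap hinr
    rw [← hfst, s.inlMap_mem_iff] at hv
    obtain ⟨w, -, hw⟩ := hC.exists_eq i _ (fun c => hve (Sum.inl c)) hv
    rw [← hfst, ← hw, ← linearCombination_linearSyzygy, ← Finsupp.range_linearCombination]
    exact ⟨w, rfl⟩
  · have h0 : v = 0 := by
      ext1 b
      cases b with
      | inl b =>
        refine hve.apply_eq_zero_of_constantCoeff_eq_zero ?_ (s.constantCoeff_eq_zero v hv _)
        exact (Nat.le_of_lt_succ he).trans (hC.deg_eq i b).ge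
      | inr j => exact hinr j
    rw [h0]
    exact Submodule.zero_mem _

theorem eq_zero_of_linearCombination_linearSyzygy_eq_zero (hC : C.IsLinearlyExact n)
    {a : C.X (i + 2)} (ha : IsHomogeneousVector (fun _ => n + i + 1) (n + i + 1) a)
    (h : Finsupp.linearCombination (MvPolynomial V k) s.linearSyzygy a = 0) : a = 0 := by
  rw [linearCombination_linearSyzygy] at h
  refine hC.eq_zero (i + 1) a (fun c u hu => ?_) (inlMap_injective (h.trans (map_zero _).symm))
  rw [hC.deg_eq]
  exact ha c u hu

variable (s)

/-- A minimal system of generators of the syzygies of a stage: the linear syzygies, completed by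
homogeneous vectors `g` of larger degrees. -/
structure MinimalGenerators where
  r : ℕ
  g : Fin r → s.X
  deg : Fin r → ℕ
  isHomogeneousCompletion :
    IsHomogeneousCompletion s.degs s.K (Set.range s.linearSyzygy) (n + i + 1) g deg
  constantCoeff_eq_zero : ∀ a,
    Finsupp.linearCombination (MvPolynomial V k) (Sum.elim s.linearSyzygy g) a = 0 →
      ∀ j, constantCoeff (a j) = 0

theorem nonempty_minimalGenerators [Finite V] (hC : C.IsLinearlyExact n) :
    Nonempty s.MinimalGenerators := by
  have := C.finite_B (i + 1)
  obtain ⟨r, g, deg, hg, hirr⟩ := exists_irredundant_isHomogeneousCompletion <|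
    s.isGradedSubmodule.exists_isHomogeneousCompletion (IsNoetherian.noetherian s.K)
      (Set.range_subset_iff.2 s.linearSyzygy_mem) fun _ he _ => mem_span_linearSyzygy hC he
  refine ⟨r, g, deg, hg, fun a ha => hg.constantCoeff_eq_zero hirr (fun b => ?_) (fun a =>
    eq_zero_of_linearCombination_linearSyzygy_eq_zero hC) ha⟩
  rw [add_assoc, ← hC.deg_eq (i + 1) b]
  exact s.isHomogeneousVector_linearSyzygy b

variable {s}

/-- The differential from the next stage, whose further generators are those of `G`. -/
abbrev MinimalGenerators.d (G : s.MinimalGenerators) :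
    (C.B (i + 2) ⊕ Fin G.r →₀ MvPolynomial V k) →ₗ[MvPolynomial V k] s.X :=
  Finsupp.linearCombination (MvPolynomial V k) (Sum.elim s.linearSyzygy G.g)

namespace MinimalGenerators

variable (G : s.MinimalGenerators)

theorem isHomogeneousMap_d : IsHomogeneousMap (Sum.elim (C.deg (i + 2)) G.deg) s.degs G.d :=
  isHomogeneousMap_linearCombination
    (Sum.rec s.isHomogeneousVector_linearSyzygy G.isHomogeneousCompletion.isHomogeneousVector)

theorem d_inlMap (v : C.X (i + 2)) :
    G.d (inlMap V k _ _ v) = inlMap V k _ _ (C.d (i + 1) v) := by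
  rw [linearCombination_elim_inlMap, linearCombination_linearSyzygy]

theorem range_d : LinearMap.range G.d = s.K := by
  rw [Finsupp.range_linearCombination, Set.Sum.elim_range, G.isHomogeneousCompletion.span_union_eq]

/-- The next stage, with the syzygies of a minimal system of generators. -/
def next : Stage C n (i + 1) where
  r := G.r
  deg := G.deg
  K := LinearMap.ker G.d
  lt_deg := G.isHomogeneousCompletion.lt_degs
  isGradedSubmodule := G.isHomogeneousMap_d.isGradedSubmodule_ker
  constantCoeff_eq_zero := G.constantCoeff_eq_zero
  inlMap_mem_iff v := by
    rw [LinearMap.mem_ker, d_inlMap, map_eq_zero_iff _ inlMap_injective]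

end MinimalGenerators

/-- The first stage: the generators are those of `C.X 1`, and the syzygies are their relations in
`C.X 0`. -/
def start (hC : C.IsLinearlyExact n) : Stage C n 0 where
  r := 0
  deg := Fin.elim0
  K := LinearMap.ker (C.d 0 ∘ₗ fstMap V k (C.B 1) (Fin 0))
  lt_deg j := j.elim0
  isGradedSubmodule := by
    refine IsHomogeneousMap.isGradedSubmodule_ker (deg := C.deg 0) ?_
    rintro (b | j)
    · rw [LinearMap.comp_apply, fstMap_single_inl]
      exact C.isHomogeneousMap_d 0 b
    · exact j.elim0
  constantCoeff_eq_zero := by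
    rintro v hv (b | j)
    · rw [LinearMap.mem_ker, LinearMap.comp_apply] at hv
      have hcomp := (C.isHomogeneousMap_d 0).component_map (n + 0) (fstMap V k (C.B 1) (Fin 0) v)
      rw [hv, map_zero] at hcomp
      have h0 := hC.eq_zero 0 _ (isHomogeneousVector_component _ _ _) hcomp.symm
      rw [← hC.deg_eq 0 b] at h0
      refine (constantCoeff_component (C.deg 1) (fstMap V k (C.B 1) (Fin 0) v) b).symm.trans ?_
      rw [h0, Finsupp.zero_apply, map_zero]
    · exact j.elim0
  inlMap_mem_iff v := by
    rw [LinearMap.mem_ker, LinearMap.comp_apply, fstMap_inlMap]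

end Stage

section

variable [Finite V] (hC : C.IsLinearlyExact n)

/-- The stages of the minimal free resolution that has the tail of `C` as its linear strand. -/
def stage : ∀ i, Stage C n i
  | 0 => Stage.start hC
  | i + 1 => (Classical.choice ((stage i).nonempty_minimalGenerators hC)).next

/-- The generators chosen for the syzygies of a stage of the resolution. -/
def generators (i : ℕ) : (stage hC i).MinimalGenerators :=
  Classical.choice ((stage hC i).nonempty_minimalGenerators hC)

theorem ker_d_generators (i : ℕ) :
    LinearMap.ker (generators hC i).d = LinearMap.range (generators hC (i + 1)).d :=
  (generators hC (i + 1)).range_d.symm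

/-- The complex underlying the minimal free resolution that has the tail of `C` as its linear
strand. -/
def resolutionComplex : GradedFreeComplex V k where
  B i := C.B (i + 1) ⊕ Fin (stage hC i).r
  finite_B i := by
    have := C.finite_B (i + 1)
    infer_instance
  deg i := (stage hC i).degs
  d i := (generators hC i).d
  homogeneous_d i b c s hs := (generators hC i).isHomogeneousMap_d b c s hs
  d_comp_d i := LinearMap.range_le_ker_iff.1 (ker_d_generators hC i).ge

/-- The minimal free resolution of the image of `C.d 0` that has the tail of `C` as its linear
strand. -/
def resolution : MinimalFreeResolution (V := V) (k := k)
    (submoduleGrading (C.deg 0) (LinearMap.range (C.d 0))) where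
  F := resolutionComplex hC
  ε := (C.d 0).rangeRestrict ∘ₗ fstMap V k (C.B 1) (Fin 0)
  homogeneous_ε := by
    rintro (b | j)
    · have h : IsHomogeneousVector (C.deg 0) (C.deg 1 b)
          (C.d 0 (fstMap V k (C.B 1) (Fin 0) (Finsupp.single (Sum.inl b) 1))) := by
        rw [fstMap_single_inl]
        exact C.isHomogeneousMap_d 0 b
      exact h
    · exact j.elim0
  surjective_ε := (LinearMap.surjective_rangeRestrict _).comp
    (Function.RightInverse.surjective fstMap_inlMap)
  exact_zero := by
    refine Eq.trans ?_ (generators hC 0).range_d.symm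
    refine Submodule.ext fun v => ?_
    rw [LinearMap.mem_ker, ← Submodule.coe_eq_zero]
    rfl
  exact_succ := ker_d_generators hC
  minimal i b := (stage hC i).constantCoeff_eq_zero _
    ((generators hC i).range_d ▸ LinearMap.mem_range_self _ _)

/-- The tail of `C` as the linear strand of the resolution. -/
def linearStrandIso : LinearStrandIso C.tail (resolution hC).F n where
  φ i := inlMap V k (C.B (i + 1)) (Fin (stage hC i).r)
  injective _ := inlMap_injective
  range_eq i := range_inlMap (fun b => (hC.deg_eq i b).trans (add_comm _ _))
    fun j => (add_comm n i ▸ (stage hC i).lt_deg j).ne'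
  homogeneous i _ _ hv := IsHomogeneousVector.inlMap (deg := C.deg (i + 1)) hv _
  comm i v := ((generators hC i).d_inlMap v).symm

end

theorem isAugmentedLinearStrand_range [Finite V] (hC : C.IsLinearlyExact n) :
    IsAugmentedLinearStrand C (submoduleGrading (C.deg 0) (LinearMap.range (C.d 0))) n :=
  ⟨resolution hC, linearStrandIso hC, Submodule.subtype _, Subtype.val_injective,
    fun _ _ hx => hx, fun v => (congrArg (C.d 0) (fstMap_inlMap v)).symm⟩

theorem hasInitialDegree_range (hC : C.IsLinearlyExact n) (b : C.B 1) :
    HasInitialDegree (submoduleGrading (C.deg 0) (LinearMap.range (C.d 0))) n := by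
  have hdeg (b : C.B 1) : C.deg 1 b = n := hC.deg_eq 0 b
  refine ⟨fun hbot => ?_, fun j hj => (AddSubgroup.eq_bot_iff_forall _).2 ?_⟩
  · have hd : C.d 0 (Finsupp.single b 1) = 0 := by
      have hmem : (C.d 0).rangeRestrict (Finsupp.single b 1) ∈
          submoduleGrading (C.deg 0) (LinearMap.range (C.d 0)) n :=
        mem_submoduleGrading.2 (hdeg b ▸ C.isHomogeneousMap_d 0 b)
      rw [hbot, AddSubgroup.mem_bot] at hmem
      exact congrArg Subtype.val hmem
    have hb : Finsupp.single b 1 ∈ C.piece 1 (n + 0) :=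
      hdeg b ▸ isHomogeneousVector_single (C.deg 1) b
    exact one_ne_zero (Finsupp.single_eq_zero.1 (hC.eq_zero 0 _ hb hd))
  · rintro ⟨_, v, rfl⟩ hx
    have h0 : component (C.deg 1) j v = 0 := Finsupp.ext fun c =>
      (isHomogeneousVector_component _ _ _).apply_eq_zero (hj.trans_eq (hdeg c).symm)
    refine Subtype.ext ?_
    rw [← isHomogeneousVector_iff_component_eq.1 (mem_submoduleGrading.1 hx),
      (C.isHomogeneousMap_d 0).component_map, h0, map_zero]
    rfl

end Resolution

end GradedFree

namespace SparseEN

/-! ### Staircases -/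

section Staircase

variable {n m : ℕ} {P : Finset (Fin n × Fin m)} {q r x y : Fin n × Fin m}

/-- The set of columns that a set of cells of an `n × m` board meets. -/
def columns (P : Finset (Fin n × Fin m)) : Finset (Fin m) := P.image Prod.snd

/-- The cells of `P` that lie in row `l`. -/
def row (P : Finset (Fin n × Fin m)) (l : Fin n) : Finset (Fin n × Fin m) := P.filter (·.1 = l)

/-- The number of cells of `P` in the columns to the left of column `a`; it determines the signs
in the differential. -/
def leftCount (P : Finset (Fin n × Fin m)) (a : Fin m) : ℕ := (P.filter (·.2 < a)).card

/-- A set of cells that meets every row, and in which each row lies strictly to the left of the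
next. Such sets are the supports of the squarefree monomials that correspond to the basis of the
sparse Eagon–Northcott complex. -/
structure IsStaircase (P : Finset (Fin n × Fin m)) : Prop where
  row_nonempty : ∀ l, (row P l).Nonempty
  snd_lt_snd : ∀ ⦃q r⦄, q ∈ P → r ∈ P → q.1 < r.1 → q.2 < r.2

theorem mem_row {l : Fin n} : q ∈ row P l ↔ q ∈ P ∧ q.1 = l := Finset.mem_filter

theorem mem_row_self (hq : q ∈ P) : q ∈ row P q.1 := mem_row.2 ⟨hq, rfl⟩

theorem snd_mem_columns (hq : q ∈ P) : q.2 ∈ columns P := Finset.mem_image_of_mem _ hq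

theorem card_eq_sum_card_row (P : Finset (Fin n × Fin m)) : P.card = ∑ l, (row P l).card :=
  Finset.card_eq_sum_card_fiberwise fun _ _ => Finset.mem_coe.2 (Finset.mem_univ _)

theorem exists_one_lt_card_row (h : n < P.card) : ∃ l, 1 < (row P l).card := by
  by_contra! hle
  have := Finset.sum_le_sum fun l (_ : l ∈ Finset.univ) => hle l
  rw [← card_eq_sum_card_row, Finset.sum_const, Finset.card_univ, Fintype.card_fin] at this
  simp only [smul_eq_mul, mul_one] at this
  exact absurd h this.not_gt

theorem row_erase (P : Finset (Fin n × Fin m)) (q : Fin n × Fin m) (l : Fin n) :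
    row (P.erase q) l = (row P l).erase q :=
  Finset.filter_erase _ _ _

theorem row_erase_of_ne {l : Fin n} (h : q.1 ≠ l) : row (P.erase q) l = row P l := by
  rw [row_erase, Finset.erase_eq_of_notMem fun hq => h (mem_row.1 hq).2]

theorem card_row_erase_add (hq : q ∈ P) (l : Fin n) :
    (row (P.erase q) l).card + (if q.1 = l then 1 else 0) = (row P l).card := by
  split_ifs with h
  · rw [row_erase, Finset.card_erase_add_one (mem_row.2 ⟨hq, h⟩)]
  · rw [row_erase_of_ne h, add_zero]

theorem leftCount_erase_add (hy : y ∈ P) (a : Fin m) :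
    leftCount (P.erase y) a + (if y.2 < a then 1 else 0) = leftCount P a := by
  rw [leftCount, leftCount, Finset.filter_erase]
  split_ifs with h
  · exact Finset.card_erase_add_one (Finset.mem_filter.2 ⟨hy, h⟩)
  · rw [Finset.erase_eq_of_notMem (by simp [h]), add_zero]

theorem leftCount_insert_self (P : Finset (Fin n × Fin m)) (x : Fin n × Fin m) :
    leftCount (insert x P) x.2 = leftCount P x.2 := by
  rw [leftCount, Finset.filter_insert, if_neg (lt_irrefl x.2), leftCount]

namespace IsStaircase

theorem eq_of_snd_eq (hP : IsStaircase P) (hq : q ∈ P) (hr : r ∈ P) (h : q.2 = r.2) : q = r := by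
  rcases lt_trichotomy q.1 r.1 with hlt | heq | hlt
  · exact absurd h (hP.snd_lt_snd hq hr hlt).ne
  · exact Prod.ext heq h
  · exact absurd h (hP.snd_lt_snd hr hq hlt).ne'

theorem injOn_snd (hP : IsStaircase P) : Set.InjOn Prod.snd (P : Set (Fin n × Fin m)) :=
  fun _ hq _ hr => hP.eq_of_snd_eq hq hr

theorem card_columns (hP : IsStaircase P) : (columns P).card = P.card :=
  Finset.card_image_of_injOn hP.injOn_snd

theorem pos_columns (hP : IsStaircase P) (a : Fin m) : pos (columns P) a = leftCount P a := by
  rw [pos, columns, Finset.filter_image, leftCount]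
  exact Finset.card_image_of_injOn (hP.injOn_snd.mono (Finset.filter_subset _ _))

theorem columns_erase (hP : IsStaircase P) (hq : q ∈ P) :
    columns (P.erase q) = (columns P).erase q.2 := by
  ext a
  simp only [columns, Finset.mem_image, Finset.mem_erase]
  constructor
  · rintro ⟨r, ⟨hrq, hr⟩, rfl⟩
    exact ⟨fun h => hrq (hP.eq_of_snd_eq hr hq h), r, hr, rfl⟩
  · rintro ⟨ha, r, hr, rfl⟩
    exact ⟨r, ⟨fun h => ha (congrArg _ h), hr⟩, rfl⟩

protected theorem erase (hP : IsStaircase P) (hq : 1 < (row P q.1).card) :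
    IsStaircase (P.erase q) where
  row_nonempty l := by
    by_cases h : q.1 = l
    · subst h
      rw [row_erase]
      exact (Finset.one_lt_card_iff_nontrivial.1 hq).erase_nonempty
    · rw [row_erase_of_ne h]
      exact hP.row_nonempty l
  snd_lt_snd _ _ hr hs :=
    hP.snd_lt_snd (Finset.mem_of_mem_erase hr) (Finset.mem_of_mem_erase hs)

theorem leftCount_eq (hP : IsStaircase P) (hq : q ∈ P) :
    leftCount P q.2 = ∑ l ∈ Finset.Iio q.1, (row P l).card +
      ((row P q.1).filter (·.2 < q.2)).card := by
  have hmaps : Set.MapsTo Prod.fst (P.filter (·.2 < q.2) : Set (Fin n × Fin m))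
      (Finset.Iic q.1 : Set (Fin n)) := by
    intro r hr
    obtain ⟨hr, hrq⟩ := Finset.mem_filter.1 (Finset.mem_coe.1 hr)
    exact Finset.mem_coe.2 (Finset.mem_Iic.2
      (not_lt.1 fun h => hrq.not_gt (hP.snd_lt_snd hq hr h)))
  have hleft : ∀ l ∈ Finset.Iio q.1, ((row P l).filter (·.2 < q.2)).card = (row P l).card := by
    intro l hl
    rw [Finset.filter_true_of_mem]
    intro r hr
    obtain ⟨hrP, rfl⟩ := mem_row.1 hr
    exact hP.snd_lt_snd hrP hq (Finset.mem_Iio.1 hl)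
  calc leftCount P q.2 = ∑ l ∈ Finset.Iic q.1, ((row P l).filter (·.2 < q.2)).card := by
        rw [leftCount, Finset.card_eq_sum_card_fiberwise hmaps]
        simp only [row, Finset.filter_comm]
    _ = _ := by
        rw [← Finset.sum_Iio_add_eq_sum_Iic, Finset.sum_congr rfl hleft]

end IsStaircase

end Staircase

/-! ### The staircase of a basis element -/

section Cells

variable {n m : ℕ} {α : Fin n → ℕ} {σ : Finset (Fin m)} {P : Finset (Fin n × Fin m)}
  {q r : Fin n × Fin m}

/-- The pairs `(l, a)` for which `a` lies in the `l`-th block of `σ`, where `σ` is cut from the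
left into consecutive blocks of sizes `α_l + 1`. -/
def cells (α : Fin n → ℕ) (σ : Finset (Fin m)) : Finset (Fin n × Fin m) :=
  Finset.univ.filter fun q => q.2 ∈ σ ∧
    q.1 + ∑ l ∈ Finset.Iio q.1, α l ≤ pos σ q.2 ∧ pos σ q.2 ≤ q.1 + ∑ l ∈ Finset.Iic q.1, α l

theorem mem_cells : q ∈ cells α σ ↔ q.2 ∈ σ ∧ q.1 + ∑ l ∈ Finset.Iio q.1, α l ≤ pos σ q.2 ∧
    pos σ q.2 ≤ q.1 + ∑ l ∈ Finset.Iic q.1, α l := by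
  simp only [cells, Finset.mem_filter, Finset.mem_univ, true_and]

theorem mem_indexSet : q ∈ indexSet α σ ↔ 0 < α q.1 ∧ q ∈ cells α σ := by
  simp only [indexSet, Finset.mem_filter, Finset.mem_univ, true_and, mem_cells]

theorem lt_of_pos_lt {a b : Fin m} (h : pos σ a < pos σ b) : a < b := by
  by_contra! hba
  exact h.not_ge (Finset.card_le_card
    (Finset.monotone_filter_right _ fun _ _ hc => hc.trans_le hba))

theorem injOn_pos (σ : Finset (Fin m)) : Set.InjOn (pos σ) (σ : Set (Fin m)) := by
  intro a ha b hb h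
  rcases lt_trichotomy a b with hab | hab | hab
  · exact absurd h (pos_lt (Finset.mem_coe.1 ha) hab).ne
  · exact hab
  · exact absurd h (pos_lt (Finset.mem_coe.1 hb) hab).ne'

theorem pos_lt_card {a : Fin m} (ha : a ∈ σ) : pos σ a < σ.card :=
  Finset.card_lt_card (Finset.filter_ssubset.2 ⟨a, ha, lt_irrefl a⟩)

theorem exists_pos_eq {p : ℕ} (hp : p < σ.card) : ∃ a ∈ σ, pos σ a = p :=
  ⟨σ.orderEmbOfFin rfl ⟨p, hp⟩, Finset.orderEmbOfFin_mem _ _ _, pos_orderEmbOfFin σ rfl _⟩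

theorem snd_lt_snd_of_mem_cells (hq : q ∈ cells α σ) (hr : r ∈ cells α σ) (h : q.1 < r.1) :
    q.2 < r.2 := by
  have hsum : ∑ l ∈ Finset.Iic q.1, α l ≤ ∑ l ∈ Finset.Iio r.1, α l :=
    Finset.sum_le_sum_of_subset fun l hl =>
      Finset.mem_Iio.2 ((Finset.mem_Iic.1 hl).trans_lt h)
  have := (mem_cells.1 hq).2.2
  have := (mem_cells.1 hr).2.1
  have : (q.1 : ℕ) < r.1 := h
  exact lt_of_pos_lt (σ := σ) (by omega)

theorem card_cells_le (α : Fin n → ℕ) (σ : Finset (Fin m)) : (cells α σ).card ≤ σ.card := by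
  refine Finset.card_le_card_of_injOn Prod.snd (fun q hq => (mem_cells.1 hq).1) ?_
  intro q hq r hr h
  rcases lt_trichotomy q.1 r.1 with hlt | heq | hlt
  · exact absurd h (snd_lt_snd_of_mem_cells hq hr hlt).ne
  · exact Prod.ext heq h
  · exact absurd h (snd_lt_snd_of_mem_cells hr hq hlt).ne'

theorem IsStaircase.cells_columns (hP : IsStaircase P) (hα : ∀ l, (row P l).card = α l + 1) :
    cells α (columns P) = P := by
  symm
  refine Finset.eq_of_subset_of_card_le (fun q hq => ?_)
    ((card_cells_le α _).trans hP.card_columns.le)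
  have hblock : ∑ l ∈ Finset.Iio q.1, (row P l).card = q.1 + ∑ l ∈ Finset.Iio q.1, α l := by
    simp only [hα, Finset.sum_add_distrib, Finset.sum_const, smul_eq_mul, mul_one, Fin.card_Iio]
    exact add_comm _ _
  have hlt : ((row P q.1).filter (·.2 < q.2)).card < (row P q.1).card :=
    Finset.card_lt_card (Finset.filter_ssubset.2 ⟨q, mem_row_self hq, lt_irrefl _⟩)
  have := hα q.1
  rw [mem_cells, hP.pos_columns, hP.leftCount_eq hq, hblock, ← Finset.sum_Iio_add_eq_sum_Iic]
  exact ⟨snd_mem_columns hq, by omega, by omega⟩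

theorem card_row_cells (h : σ.card = n + ∑ l, α l) (l : Fin n) :
    (row (cells α σ) l).card = α l + 1 := by
  have hbound : l + ∑ i ∈ Finset.Iic l, α i < σ.card := by
    rw [h]
    exact Nat.add_lt_add_of_lt_of_le l.isLt (Finset.sum_le_sum_of_subset (Finset.subset_univ _))
  have himage : (row (cells α σ) l).image (fun q => pos σ q.2) =
      Finset.Icc (l + ∑ i ∈ Finset.Iio l, α i) (l + ∑ i ∈ Finset.Iic l, α i) := by
    ext p
    simp only [Finset.mem_image, mem_row, mem_cells, Finset.mem_Icc]
    constructor
    · rintro ⟨q, ⟨⟨-, hq⟩, rfl⟩, rfl⟩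
      exact hq
    · intro hp
      obtain ⟨a, ha, rfl⟩ := exists_pos_eq (hp.2.trans_lt hbound)
      exact ⟨(l, a), ⟨⟨ha, hp⟩, rfl⟩, rfl⟩
  have hinj : Set.InjOn (fun q : Fin n × Fin m => pos σ q.2) (row (cells α σ) l) := by
    intro q hq r hr h
    obtain ⟨hq, hql⟩ := mem_row.1 (Finset.mem_coe.1 hq)
    obtain ⟨hr, hrl⟩ := mem_row.1 (Finset.mem_coe.1 hr)
    exact Prod.ext (hql.trans hrl.symm) (injOn_pos σ (mem_cells.1 hq).1 (mem_cells.1 hr).1 h)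
  rw [← Finset.card_image_of_injOn hinj, himage, Nat.card_Icc, ← Finset.sum_Iio_add_eq_sum_Iic]
  omega

theorem isStaircase_cells (h : σ.card = n + ∑ l, α l) : IsStaircase (cells α σ) where
  row_nonempty l := Finset.card_pos.1 (by rw [card_row_cells h]; exact Nat.succ_pos _)
  snd_lt_snd _ _ := snd_lt_snd_of_mem_cells

theorem columns_cells (h : σ.card = n + ∑ l, α l) : columns (cells α σ) = σ := by
  refine Finset.eq_of_subset_of_card_le (fun a ha => ?_) ?_
  · obtain ⟨q, hq, rfl⟩ := Finset.mem_image.1 ha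
    exact (mem_cells.1 hq).1
  · rw [(isStaircase_cells h).card_columns, card_eq_sum_card_row, h]
    simp only [card_row_cells h, Finset.sum_add_distrib, Finset.sum_const, Finset.card_univ,
      Fintype.card_fin, smul_eq_mul, mul_one]
    exact (add_comm _ _).le

end Cells

section Idx

/-- A staircase with `n + i` cells whose columns form a face of `Δ`; these index the basis in
homological degree `i + 1`. -/
structure IsFaceStaircase {n m : ℕ} (Δ : PreAbstractSimplicialComplex (Fin m)) (i : ℕ)
    (P : Finset (Fin n × Fin m)) : Prop extends IsStaircase P where
  columns_mem : columns P ∈ Δ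
  card_eq : P.card = n + i

variable {n m i : ℕ} {Δ : PreAbstractSimplicialComplex (Fin m)} {P : Finset (Fin n × Fin m)}
  {q : Fin n × Fin m}

theorem Idx.card_eq_add_sum (b : Idx n Δ i) : b.1.2.card = n + ∑ l, b.1.1 l := by
  rw [b.2.2.1, b.2.2.2]

/-- The staircase of the basis element `g^{*(α)} ⊗ f_σ`: it has the columns `σ`, and `α_l + 1`
cells in row `l`. -/
def Idx.cells (b : Idx n Δ i) : Finset (Fin n × Fin m) := SparseEN.cells b.1.1 b.1.2

theorem Idx.isStaircase_cells (b : Idx n Δ i) : IsStaircase b.cells :=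
  SparseEN.isStaircase_cells b.card_eq_add_sum

theorem Idx.columns_cells (b : Idx n Δ i) : columns b.cells = b.1.2 :=
  SparseEN.columns_cells b.card_eq_add_sum

theorem Idx.card_row_cells (b : Idx n Δ i) (l : Fin n) : (row b.cells l).card = b.1.1 l + 1 :=
  SparseEN.card_row_cells b.card_eq_add_sum l

theorem Idx.card_cells (b : Idx n Δ i) : b.cells.card = n + i := by
  rw [← b.isStaircase_cells.card_columns, b.columns_cells, b.2.2.1]

theorem Idx.cells_injective : Function.Injective (Idx.cells : Idx n Δ i → _) := by
  intro b c h
  refine Subtype.ext (Prod.ext (funext fun l => Nat.succ_injective ?_) ?_)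
  · exact (b.card_row_cells l).symm.trans (h ▸ c.card_row_cells l)
  · rw [← b.columns_cells, h, c.columns_cells]

theorem Idx.isFaceStaircase_cells (b : Idx n Δ i) : IsFaceStaircase Δ i b.cells :=
  ⟨b.isStaircase_cells, b.columns_cells ▸ b.2.1, b.card_cells⟩

theorem IsFaceStaircase.exists_cells_eq (hP : IsFaceStaircase Δ i P) :
    ∃ b : Idx n Δ i, b.cells = P := by
  have hrow (l : Fin n) : (row P l).card = ((row P l).card - 1) + 1 :=
    (Nat.sub_add_cancel (hP.row_nonempty l).card_pos).symm
  have hsum : n + ∑ l, ((row P l).card - 1) = n + i := by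
    rw [← hP.card_eq, card_eq_sum_card_row, Finset.sum_congr rfl fun l _ => hrow l,
      Finset.sum_add_distrib, Finset.sum_const, Finset.card_univ, Fintype.card_fin]
    simp only [smul_eq_mul, mul_one, add_comm]
  exact ⟨⟨(fun l => (row P l).card - 1, columns P), hP.columns_mem,
    hP.card_columns.trans hP.card_eq, Nat.add_left_cancel hsum⟩, hP.cells_columns hrow⟩

theorem Idx.mem_indexSet_iff (b : Idx n Δ i) :
    q ∈ indexSet b.1.1 b.1.2 ↔ q ∈ b.cells ∧ 1 < (row b.cells q.1).card := by
  rw [mem_indexSet, b.card_row_cells, Nat.lt_add_left_iff_pos, and_comm, Idx.cells]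

theorem Idx.cells_remove (b : Idx n Δ (i + 1)) (hq : q ∈ indexSet b.1.1 b.1.2) :
    (b.remove q hq).cells = b.cells.erase q := by
  obtain ⟨hmem, hrow⟩ := b.mem_indexSet_iff.1 hq
  have hα (l : Fin n) : (row (b.cells.erase q) l).card = (b.remove q hq).1.1 l + 1 := by
    have h := card_row_erase_add hmem l
    have hpos := (mem_indexSet.1 hq).1
    rw [b.card_row_cells] at h
    by_cases hl : q.1 = l
    · subst hl
      simp only [Idx.remove, Pi.sub_apply, Pi.single_eq_same, if_true] at h ⊢
      omega
    · simpa only [Idx.remove, Pi.sub_apply, Pi.single_eq_of_ne' hl, if_neg hl, add_zero,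
        Nat.sub_zero] using h
  rw [← (b.isStaircase_cells.erase hrow).cells_columns hα, b.isStaircase_cells.columns_erase hmem,
    b.columns_cells]
  rfl

end Idx

/-! ### Linear cycles -/

section LinearCycle

variable {n m i : ℕ} {k : Type*} [CommRing k] {Δ : PreAbstractSimplicialComplex (Fin m)}
  {P S : Finset (Fin n × Fin m)} {q r x y : Fin n × Fin m}

theorem isNonface_one {σ : Finset (Fin m)} {a b : Fin m} (hσ : σ ∉ Δ) (ha : a ∈ σ) (hb : b ∈ σ)
    (hab : pos σ b = pos σ a + 1) (ha' : σ.erase a ∈ Δ) (hb' : σ.erase b ∈ Δ) :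
    IsNonface Δ 1 σ := by
  have hemb {p : ℕ} (hp : p < σ.card) {c : Fin m} (hc : c ∈ σ) (h : pos σ c = p) :
      σ.orderEmbOfFin rfl ⟨p, hp⟩ = c :=
    injOn_pos σ (Finset.orderEmbOfFin_mem _ _ _) hc ((pos_orderEmbOfFin σ rfl _).trans h.symm)
  refine ⟨hσ, pos σ a, hab ▸ pos_lt_card hb, fun l hl => ?_⟩
  rcases Nat.le_one_iff_eq_zero_or_eq_one.1 hl with rfl | rfl
  · exact (hemb _ ha rfl).symm ▸ ha'
  · exact (hemb _ hb hab).symm ▸ hb'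

theorem IsStaircase.le_card (hP : IsStaircase P) : n ≤ P.card := by
  have hsum : ∑ _l : Fin n, 1 ≤ ∑ l, (row P l).card :=
    Finset.sum_le_sum fun l _ => (hP.row_nonempty l).card_pos
  rwa [← card_eq_sum_card_row, Finset.sum_const, Finset.card_univ, Fintype.card_fin,
    smul_eq_mul, mul_one] at hsum

theorem IsStaircase.leftCount_eq_add_one (hP : IsStaircase P) (hrow : row P x.1 = {x, y})
    (hxy : x.2 < y.2) : leftCount P y.2 = leftCount P x.2 + 1 := by
  have hx : x ∈ P ∧ x.1 = x.1 := mem_row.1 (hrow ▸ Finset.mem_insert_self x _)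
  have hy : y ∈ P ∧ y.1 = x.1 :=
    mem_row.1 (hrow ▸ Finset.mem_insert_of_mem (Finset.mem_singleton_self y))
  rw [hP.leftCount_eq hx.1, hP.leftCount_eq hy.1, hy.2, hrow]
  simp [Finset.filter_insert, Finset.filter_singleton, hxy, hxy.not_gt]

theorem IsStaircase.columns_mem (hΔ : ∀ σ : Finset (Fin m), n + 1 ≤ σ.card → ¬IsNonface Δ 1 σ)
    (hP : IsStaircase P) {l : Fin n} (hl : 1 < (row P l).card)
    (hface : ∀ q ∈ row P l, columns (P.erase q) ∈ Δ) : columns P ∈ Δ := by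
  obtain ⟨q, hq, r, hr, hqr⟩ : ∃ q ∈ row P l, ∃ r ∈ row P l, q.2 < r.2 := by
    obtain ⟨q, hq, r, hr, hne⟩ := Finset.one_lt_card.1 hl
    have hne' : q.2 ≠ r.2 := fun h =>
      hne (hP.eq_of_snd_eq (mem_row.1 hq).1 (mem_row.1 hr).1 h)
    exact hne'.lt_or_gt.elim (fun h => ⟨q, hq, r, hr, h⟩) fun h => ⟨r, hr, q, hq, h⟩
  obtain ⟨hqP, hql⟩ := mem_row.1 hq
  obtain ⟨hrP, hrl⟩ := mem_row.1 hr
  have hpos := pos_lt (snd_mem_columns hqP) hqr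
  have hlt := pos_lt_card (snd_mem_columns hrP)
  obtain ⟨a, ha, has⟩ := exists_pos_eq (σ := columns P) (p := pos (columns P) q.2 + 1) (by omega)
  obtain ⟨s, hs, rfl⟩ := Finset.mem_image.1 ha
  have hqs : q.2 < s.2 := lt_of_pos_lt (σ := columns P) (by omega)
  have hsr : s.2 ≤ r.2 := not_lt.1 fun h => by
    have := pos_lt (snd_mem_columns hrP) h
    omega
  have hsl : s.1 = l := by
    rcases lt_trichotomy s.1 l with h | h | h
    · exact absurd (hP.snd_lt_snd hs hqP (hql ▸ h)) hqs.not_gt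
    · exact h
    · exact absurd (hP.snd_lt_snd hrP hs (hrl ▸ h)) hsr.not_gt
  by_contra hcol
  refine hΔ _ ?_ (isNonface_one hcol (snd_mem_columns hqP) ha has ?_ ?_)
  · rw [hP.card_columns, ← Finset.card_erase_add_one hqP]
    exact Nat.succ_le_succ (hP.erase (hql ▸ hl)).le_card
  · exact hP.columns_erase hqP ▸ hface q hq
  · exact hP.columns_erase hs ▸ hface s (mem_row.2 ⟨hs, hsl⟩)

protected theorem IsFaceStaircase.erase (hP : IsFaceStaircase Δ (i + 1) P) (hq : q ∈ P)
    (hrow : 1 < (row P q.1).card) : IsFaceStaircase Δ i (P.erase q) where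
  toIsStaircase := hP.toIsStaircase.erase hrow
  columns_mem := by
    have hne : (columns (P.erase q)).Nonempty :=
      let ⟨r, hr⟩ := (hP.toIsStaircase.erase hrow).row_nonempty q.1
      ⟨r.2, snd_mem_columns (mem_row.1 hr).1⟩
    exact (Δ.isRelLowerSet_faces hP.columns_mem).2
      (Finset.image_subset_image (Finset.erase_subset _ _)) hne
  card_eq := by rw [Finset.card_erase_of_mem hq, hP.card_eq, ← add_assoc, Nat.add_sub_cancel]

theorem IsFaceStaircase.eq_of_fst_eq (hP : IsFaceStaircase Δ 0 P) (hq : q ∈ P) (hr : r ∈ P)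
    (h : q.1 = r.1) : q = r := by
  by_contra hne
  have hrow : 1 < (row P q.1).card :=
    Finset.one_lt_card.2 ⟨q, mem_row_self hq, r, mem_row.2 ⟨hr, h.symm⟩, hne⟩
  have hle := (hP.toIsStaircase.erase hrow).le_card
  have := Finset.card_erase_add_one hq
  rw [hP.card_eq] at this
  omega

/-- The relations satisfied by the coefficients `c P x` of `x` at the basis element `P` in a
linear cycle of homological degree at least two; `c` is defined on all sets of cells and vanishes
away from the basis. -/
structure IsLinearCycle (Δ : PreAbstractSimplicialComplex (Fin m)) (i : ℕ)
    (c : Finset (Fin n × Fin m) → Fin n × Fin m → k) : Prop where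
  isFaceStaircase : ∀ ⦃P x⦄, c P x ≠ 0 → IsFaceStaircase Δ (i + 1) P
  insert_self : ∀ ⦃T⦄ x, IsFaceStaircase Δ i T → c (insert x T) x = 0
  insert_swap : ∀ ⦃T x y⦄, IsFaceStaircase Δ i T → x ≠ y →
    (-1) ^ leftCount T x.2 * c (insert x T) y + (-1) ^ leftCount T y.2 * c (insert y T) x = 0

/-- The relations satisfied by the coefficients `c P x` of `x` at the basis element `P` in a
linear cycle of homological degree one. -/
structure IsInitialLinearCycle (Δ : PreAbstractSimplicialComplex (Fin m))
    (c : Finset (Fin n × Fin m) → Fin n × Fin m → k) : Prop where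
  isFaceStaircase : ∀ ⦃P x⦄, c P x ≠ 0 → IsFaceStaircase Δ 0 P
  eq_zero_of_mem : ∀ ⦃P x⦄, x ∈ P → c P x = 0
  sum_erase : ∀ ⦃P⦄, P.card = n + 1 → ∑ x ∈ P, c (P.erase x) x = 0

variable {c : Finset (Fin n × Fin m) → Fin n × Fin m → k}

theorem neg_one_pow_mul_eq {R : Type*} [CommRing R] {a b : ℕ} {u v : R}
    (h : (-1) ^ a * u + (-1) ^ b * v = 0) : (-1) ^ a * v = (-1) ^ (b + 1) * u := by
  have ha : ((-1 : R) ^ a) ^ 2 = 1 := by rw [← pow_mul, mul_comm, pow_mul, neg_one_sq, one_pow]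
  have hb : ((-1 : R) ^ b) ^ 2 = 1 := by rw [← pow_mul, mul_comm, pow_mul, neg_one_sq, one_pow]
  linear_combination (-1) ^ a * (-1) ^ b * h - (-1) ^ b * u * ha - (-1) ^ a * v * hb

namespace IsLinearCycle

theorem notMem_and_isFaceStaircase (hc : IsLinearCycle Δ i c) (hx : c S x ≠ 0) (hy : y ∈ S)
    (hrow : 1 < (row S y.1).card) :
    x ∉ S ∧ x ≠ y ∧ IsFaceStaircase Δ (i + 1) (insert x (S.erase y)) := by
  have hS := hc.isFaceStaircase hx
  have hT := hS.erase hy hrow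
  have hinsert : insert y (S.erase y) = S := Finset.insert_erase hy
  have hxy : x ≠ y := by
    rintro rfl
    exact hx (hinsert ▸ hc.insert_self x hT)
  have hface : IsFaceStaircase Δ (i + 1) (insert x (S.erase y)) := by
    refine hc.isFaceStaircase (x := y) fun h0 => hx ?_
    have := hc.insert_swap hT hxy
    rw [h0, mul_zero, zero_add, hinsert] at this
    exact (isUnit_one.neg.pow _).mul_right_eq_zero.1 this
  refine ⟨fun hxS => ?_, hxy, hface⟩
  have := hface.card_eq
  rw [Finset.insert_eq_of_mem (Finset.mem_erase.2 ⟨hxy, hxS⟩), hT.card_eq] at this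
  omega

theorem isStaircase_insert (hc : IsLinearCycle Δ i c) (hx : c S x ≠ 0) :
    IsStaircase (insert x S) := by
  have hS := hc.isFaceStaircase hx
  obtain ⟨l, hl⟩ := exists_one_lt_card_row (P := S) (by rw [hS.card_eq]; omega)
  -- Any `r ∈ S` lies in the staircase `insert x (S.erase y)` for one of the two choices of `y`.
  have hor (r : Fin n × Fin m) (hr : r ∈ S) :
      ∃ T, IsStaircase T ∧ x ∈ T ∧ r ∈ T := by
    obtain ⟨y, hy, hyr⟩ := Finset.exists_mem_ne hl r
    obtain ⟨hyS, rfl⟩ := mem_row.1 hy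
    exact ⟨_, (hc.notMem_and_isFaceStaircase hx hyS hl).2.2.toIsStaircase,
      Finset.mem_insert_self _ _,
      Finset.mem_insert_of_mem (Finset.mem_erase.2 ⟨hyr.symm, hr⟩)⟩
  refine ⟨fun l => (hS.row_nonempty l).mono
    (Finset.filter_subset_filter _ (Finset.subset_insert _ _)), fun q r hq hr hqr => ?_⟩
  rcases Finset.mem_insert.1 hq with rfl | hqS <;> rcases Finset.mem_insert.1 hr with rfl | hrS
  · exact absurd hqr (lt_irrefl _)
  · obtain ⟨T, hT, hxT, hrT⟩ := hor r hrS
    exact hT.snd_lt_snd hxT hrT hqr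
  · obtain ⟨T, hT, hxT, hqT⟩ := hor q hqS
    exact hT.snd_lt_snd hqT hxT hqr
  · exact hS.snd_lt_snd hqS hrS hqr

theorem isFaceStaircase_insert
    (hΔ : ∀ σ : Finset (Fin m), n + 1 ≤ σ.card → ¬IsNonface Δ 1 σ)
    (hc : IsLinearCycle Δ i c) (hx : c S x ≠ 0) : IsFaceStaircase Δ (i + 2) (insert x S) := by
  have hS := hc.isFaceStaircase hx
  obtain ⟨l, hl⟩ := exists_one_lt_card_row (P := S) (by rw [hS.card_eq]; omega)
  have hxS : x ∉ S :=
    let ⟨_, hy⟩ := Finset.card_pos.1 (one_pos.trans hl)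
    (hc.notMem_and_isFaceStaircase hx (mem_row.1 hy).1 ((mem_row.1 hy).2 ▸ hl)).1
  have hP := hc.isStaircase_insert hx
  refine ⟨hP, hP.columns_mem hΔ (l := l) (hl.trans_le (Finset.card_le_card
    (Finset.filter_subset_filter _ (Finset.subset_insert _ _)))) fun q hq => ?_, ?_⟩
  · obtain ⟨hqP, rfl⟩ := mem_row.1 hq
    rcases Finset.mem_insert.1 hqP with rfl | hqS
    · rw [Finset.erase_insert hxS]
      exact hS.columns_mem
    · obtain ⟨-, hxq, hface⟩ := hc.notMem_and_isFaceStaircase hx hqS hl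
      rw [Finset.erase_insert_of_ne hxq]
      exact hface.columns_mem
  · rw [Finset.card_insert_of_notMem hxS, hS.card_eq, add_assoc]

theorem sign_mul_eq_of_erase (hc : IsLinearCycle Δ i c) (hP : IsFaceStaircase Δ (i + 2) P)
    (hx : x ∈ P) (hxrow : 1 < (row P x.1).card) (hy : y ∈ P.erase x)
    (hyrow : 1 < (row (P.erase x) y.1).card) :
    (-1) ^ leftCount P x.2 * c (P.erase x) x = (-1) ^ leftCount P y.2 * c (P.erase y) y := by
  obtain ⟨hyx, hyP⟩ := Finset.mem_erase.1 hy
  have hT : IsFaceStaircase Δ i ((P.erase x).erase y) := (hP.erase hx hxrow).erase hy hyrow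
  have hxT : insert x ((P.erase x).erase y) = P.erase y := by
    rw [Finset.erase_right_comm]
    exact Finset.insert_erase (Finset.mem_erase.2 ⟨hyx.symm, hx⟩)
  have hyT : insert y ((P.erase x).erase y) = P.erase x := Finset.insert_erase hy
  have hswap := hc.insert_swap hT hyx.symm
  rw [hxT, hyT] at hswap
  have hlx := leftCount_erase_add hx x.2
  have hlx' := leftCount_erase_add hy x.2
  have hly := leftCount_erase_add hx y.2
  have hly' := leftCount_erase_add hy y.2
  simp only [lt_irrefl, if_false, add_zero] at hlx hly'
  have hne : x.2 ≠ y.2 := fun h => hyx (hP.eq_of_snd_eq hx hyP h).symm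
  rcases hne.lt_or_gt with h | h
  · rw [if_neg h.not_gt, add_zero] at hlx'
    rw [if_pos h] at hly
    rw [← hlx, ← hlx', ← hly, ← hly']
    exact neg_one_pow_mul_eq hswap
  · rw [if_pos h] at hlx'
    rw [if_neg h.not_gt, add_zero] at hly
    rw [← hlx, ← hlx', ← hly, ← hly']
    exact (neg_one_pow_mul_eq ((add_comm _ _).trans hswap)).symm

theorem sign_mul_eq (hc : IsLinearCycle Δ i c) (hP : IsFaceStaircase Δ (i + 2) P)
    (hx : x ∈ P) (hxrow : 1 < (row P x.1).card) (hy : y ∈ P) (hyrow : 1 < (row P y.1).card) :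
    (-1) ^ leftCount P x.2 * c (P.erase x) x = (-1) ^ leftCount P y.2 * c (P.erase y) y := by
  obtain rfl | hxy := eq_or_ne x y
  · rfl
  obtain ⟨l, hl⟩ := exists_one_lt_card_row (P := P.erase x)
    (by rw [(hP.erase hx hxrow).card_eq]; omega)
  by_cases hyrow' : 1 < (row (P.erase x) y.1).card
  · exact hc.sign_mul_eq_of_erase hP hx hxrow (Finset.mem_erase.2 ⟨hxy.symm, hy⟩) hyrow'
  -- Now `x` and `y` are the only cells of their row, and we pass through a cell of another row.
  have hxy' : x.1 = y.1 := by
    by_contra h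
    exact hyrow' (by rwa [row_erase_of_ne h])
  obtain ⟨z, hz⟩ := Finset.card_pos.1 (one_pos.trans hl)
  obtain ⟨hzP, rfl⟩ := mem_row.1 hz
  have hzy : y.1 ≠ z.1 := fun h => hyrow' (h ▸ hl)
  rw [hc.sign_mul_eq_of_erase hP hx hxrow hzP hl]
  refine (hc.sign_mul_eq_of_erase hP hy hyrow (Finset.mem_erase.2
    ⟨fun h => hzy (congrArg _ h.symm), Finset.mem_of_mem_erase hzP⟩) ?_).symm
  rw [row_erase_of_ne hzy]
  exact row_erase_of_ne (hxy' ▸ hzy) ▸ hl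

end IsLinearCycle

namespace IsInitialLinearCycle

theorem exists_erase_ne_zero (hc : IsInitialLinearCycle Δ c) (hP : P.card = n + 1) (hx : x ∈ P)
    (h : c (P.erase x) x ≠ 0) : ∃ y ∈ P, y ≠ x ∧ y.1 = x.1 ∧ c (P.erase y) y ≠ 0 := by
  obtain ⟨y, hy, hyc⟩ : ∃ y ∈ P.erase x, c (P.erase y) y ≠ 0 := by
    by_contra! h0
    refine h ?_
    rw [← hc.sum_erase hP, ← Finset.add_sum_erase P _ hx, Finset.sum_eq_zero h0, add_zero]
  obtain ⟨hyx, hyP⟩ := Finset.mem_erase.1 hy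
  obtain ⟨r, hr⟩ := (hc.isFaceStaircase hyc).row_nonempty y.1
  obtain ⟨hrP, hry⟩ := mem_row.1 hr
  obtain ⟨hne, hrP⟩ := Finset.mem_erase.1 hrP
  obtain rfl : r = x := by
    by_contra hrx
    exact hne ((hc.isFaceStaircase h).eq_of_fst_eq (Finset.mem_erase.2 ⟨hrx, hrP⟩) hy hry)
  exact ⟨y, hyP, hyx, hry.symm, hyc⟩

theorem isFaceStaircase_insert
    (hΔ : ∀ σ : Finset (Fin m), n + 1 ≤ σ.card → ¬IsNonface Δ 1 σ)
    (hc : IsInitialLinearCycle Δ c) (hx : c S x ≠ 0) : IsFaceStaircase Δ 1 (insert x S) := by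
  have hS := hc.isFaceStaircase hx
  have hxS : x ∉ S := fun h => hx (hc.eq_zero_of_mem h)
  have hcard : (insert x S).card = n + 1 := by rw [Finset.card_insert_of_notMem hxS, hS.card_eq]
  obtain ⟨y, hy, hyx, hyrow, hyc⟩ := hc.exists_erase_ne_zero hcard (Finset.mem_insert_self x S)
    (by rwa [Finset.erase_insert hxS])
  have hyS : y ∈ S := Finset.mem_of_mem_insert_of_ne hy hyx
  have hSy := hc.isFaceStaircase hyc
  have hxy {r : Fin n × Fin m} (hr : r ∈ insert x S) (hrx : r.1 ≠ x.1) :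
      r ∈ S ∧ r ∈ (insert x S).erase y :=
    ⟨Finset.mem_of_mem_insert_of_ne hr fun h => hrx (congrArg _ h),
      Finset.mem_erase.2 ⟨fun h => hrx (h ▸ hyrow), hr⟩⟩
  have hxe : x ∈ (insert x S).erase y :=
    Finset.mem_erase.2 ⟨hyx.symm, Finset.mem_insert_self _ _⟩
  have hP : IsStaircase (insert x S) := by
    refine ⟨fun l => (hS.row_nonempty l).mono
      (Finset.filter_subset_filter _ (Finset.subset_insert _ _)), fun q r hq hr hqr => ?_⟩
    rcases Finset.mem_insert.1 hq with rfl | hqS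
    · exact hSy.snd_lt_snd hxe (hxy hr hqr.ne').2 hqr
    rcases Finset.mem_insert.1 hr with rfl | hrS
    · exact hSy.snd_lt_snd (hxy hq hqr.ne).2 hxe hqr
    · exact hS.snd_lt_snd hqS hrS hqr
  refine ⟨hP, hP.columns_mem hΔ (l := x.1) (Finset.one_lt_card.2 ⟨x, mem_row_self
    (Finset.mem_insert_self x S), y, mem_row.2 ⟨hy, hyrow⟩, hyx.symm⟩) fun q hq => ?_, hcard⟩
  obtain ⟨hqP, hqx⟩ := mem_row.1 hq
  rcases Finset.mem_insert.1 hqP with rfl | hqS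
  · rw [Finset.erase_insert hxS]
    exact hS.columns_mem
  · rw [hS.eq_of_fst_eq hqS hyS (hqx.trans hyrow.symm)]
    exact hSy.columns_mem

theorem sign_mul_eq (hc : IsInitialLinearCycle Δ c) (hP : IsFaceStaircase Δ 1 P)
    (hx : x ∈ P) (hxrow : 1 < (row P x.1).card) (hy : y ∈ P) (hyrow : 1 < (row P y.1).card) :
    (-1) ^ leftCount P x.2 * c (P.erase x) x = (-1) ^ leftCount P y.2 * c (P.erase y) y := by
  wlog hxy : x.2 < y.2 generalizing x y
  · rcases (not_lt.1 hxy).eq_or_lt with h | h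
    · rw [hP.eq_of_snd_eq hy hx h]
    · exact (this hy hyrow hx hxrow h).symm
  have hne : x ≠ y := fun h => hxy.ne (congrArg _ h)
  have hface : IsFaceStaircase Δ 0 (P.erase x) := hP.erase hx hxrow
  have hyx : y ∈ P.erase x := Finset.mem_erase.2 ⟨hne.symm, hy⟩
  have hfst : x.1 = y.1 := by
    obtain ⟨z, hz, hzy⟩ := Finset.exists_mem_ne hyrow y
    obtain ⟨hzP, hzrow⟩ := mem_row.1 hz
    by_contra hxy
    have hzx : z ≠ x := fun h => hxy (h ▸ hzrow)
    exact hzy (hface.eq_of_fst_eq (Finset.mem_erase.2 ⟨hzx, hzP⟩) hyx hzrow)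
  have hrow : row P x.1 = {x, y} := by
    ext z
    rw [mem_row, Finset.mem_insert, Finset.mem_singleton]
    constructor
    · rintro ⟨hz, hzx⟩
      refine or_iff_not_imp_left.2 fun hne => ?_
      exact hface.eq_of_fst_eq (Finset.mem_erase.2 ⟨hne, hz⟩) hyx (hzx.trans hfst)
    · rintro (rfl | rfl)
      · exact ⟨hx, rfl⟩
      · exact ⟨hy, hfst.symm⟩
  have hsum : c (P.erase x) x + c (P.erase y) y = 0 := by
    rw [← hc.sum_erase hP.card_eq]
    refine (Finset.sum_eq_add_of_mem (f := fun z => c (P.erase z) z) x y hx hy hne ?_).symm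
    rintro z - ⟨hzx, hzy⟩
    by_contra h
    exact hne ((hc.isFaceStaircase h).eq_of_fst_eq (Finset.mem_erase.2 ⟨hzx.symm, hx⟩)
      (Finset.mem_erase.2 ⟨hzy.symm, hy⟩) hfst)
  rw [hP.leftCount_eq_add_one hrow hxy, eq_neg_of_add_eq_zero_left hsum, pow_succ]
  ring

end IsInitialLinearCycle

theorem exists_weight (hface : ∀ ⦃S x⦄, c S x ≠ 0 → IsFaceStaircase Δ (i + 1) (insert x S))
    (hsign : ∀ ⦃P x y⦄, IsFaceStaircase Δ (i + 1) P → x ∈ P → 1 < (row P x.1).card → y ∈ P →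
      1 < (row P y.1).card → (-1) ^ leftCount P x.2 * c (P.erase x) x =
        (-1) ^ leftCount P y.2 * c (P.erase y) y) :
    ∃ w : Finset (Fin n × Fin m) → k, (∀ P, w P ≠ 0 → IsFaceStaircase Δ (i + 1) P) ∧
      ∀ S x, IsFaceStaircase Δ i S → c S x = (-1) ^ leftCount S x.2 * w (insert x S) := by
  classical
  have hex (P : Finset (Fin n × Fin m)) (hP : IsFaceStaircase Δ (i + 1) P) :
      ∃ a : k, ∀ x ∈ P, 1 < (row P x.1).card →
        (-1) ^ leftCount P x.2 * c (P.erase x) x = a := by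
    obtain ⟨l, hl⟩ := exists_one_lt_card_row (P := P) (by rw [hP.card_eq]; omega)
    obtain ⟨y, hy⟩ := Finset.card_pos.1 (one_pos.trans hl)
    obtain ⟨hyP, rfl⟩ := mem_row.1 hy
    exact ⟨_, fun x hx hxrow => hsign hP hx hxrow hyP hl⟩
  choose! w hw using hex
  refine ⟨fun P => if IsFaceStaircase Δ (i + 1) P then w P else 0,
    fun P hP => by_contra fun h => hP (if_neg h), fun S x hS => ?_⟩
  dsimp only
  split_ifs with hP
  · have hxS : x ∉ S := fun h => by
      have := hP.card_eq
      rw [Finset.insert_eq_of_mem h, hS.card_eq] at this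
      omega
    have hrow : 1 < (row (insert x S) x.1).card := by
      obtain ⟨r, hr⟩ := hS.row_nonempty x.1
      obtain ⟨hrS, hrx⟩ := mem_row.1 hr
      exact Finset.one_lt_card.2 ⟨x, mem_row_self (Finset.mem_insert_self _ _), r,
        mem_row.2 ⟨Finset.mem_insert_of_mem hrS, hrx⟩, fun h => hxS (h ▸ hrS)⟩
    rw [← hw _ hP x (Finset.mem_insert_self _ _) hrow, Finset.erase_insert hxS,
      leftCount_insert_self, ← mul_assoc, ← mul_pow, neg_one_mul, neg_neg, one_pow, one_mul]
  · rw [mul_zero]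
    exact by_contra fun h => hP (hface h)

end LinearCycle

/-! ### Coefficients of the differential -/

section Differential

variable {n m i : ℕ} {k : Type u} [Field k] {Δ : PreAbstractSimplicialComplex (Fin m)}
  {P Q : Finset (Fin n × Fin m)} {x y : Fin n × Fin m}

theorem mapDomain_cells_apply {M : Type*} [AddCommMonoid M] (v : Idx n Δ i →₀ M)
    (b : Idx n Δ i) : v.mapDomain Idx.cells b.cells = v b :=
  Finsupp.mapDomain_apply Idx.cells_injective v b

theorem isFaceStaircase_of_mapDomain_cells_ne_zero {M : Type*} [AddCommMonoid M]
    {v : Idx n Δ i →₀ M} (h : v.mapDomain Idx.cells P ≠ 0) : IsFaceStaircase Δ i P := by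
  by_contra hP
  refine h (Finsupp.mapDomain_of_notMem_range v P ?_)
  rintro ⟨b, rfl⟩
  exact hP b.isFaceStaircase_cells

theorem Idx.cells_eq_insert_iff {b : Idx n Δ (i + 1)} {T : Idx n Δ i} :
    b.cells = insert x T.cells ↔ ∃ h : x ∈ indexSet b.1.1 b.1.2, b.remove x h = T := by
  constructor
  · intro h
    have hx : x ∈ b.cells := h ▸ Finset.mem_insert_self _ _
    have hxT : x ∉ T.cells := fun hxT => by
      have := b.card_cells
      rw [h, Finset.insert_eq_of_mem hxT, T.card_cells] at this
      omega
    have herase : b.cells.erase x = T.cells := by rw [h, Finset.erase_insert hxT]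
    have hrow : 1 < (row b.cells x.1).card := by
      have := card_row_erase_add hx x.1
      have := (T.isStaircase_cells.row_nonempty x.1).card_pos
      simp only [herase, if_true] at *
      omega
    have hx' := b.mem_indexSet_iff.2 ⟨hx, hrow⟩
    exact ⟨hx', Idx.cells_injective ((b.cells_remove hx').trans herase)⟩
  · rintro ⟨h, rfl⟩
    rw [b.cells_remove, Finset.insert_erase (b.mem_indexSet_iff.1 h).1]

theorem dIdx_apply (b : Idx n Δ (i + 1)) (T : Idx n Δ i) :
    (dIdx b : Idx n Δ i →₀ Ring n m k) T = ∑ x : Fin n × Fin m,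
      if b.cells = insert x T.cells then (-1) ^ leftCount T.cells x.2 * X (toLex x) else 0 := by
  classical
  have hterm (q : Fin n × Fin m) (hq : q ∈ indexSet b.1.1 b.1.2) :
      Finsupp.single (b.remove q hq) ((-1) ^ pos b.1.2 q.2 * X (toLex q) : Ring n m k) T =
        if b.cells = insert q T.cells then (-1) ^ leftCount T.cells q.2 * X (toLex q) else 0 := by
    rw [Finsupp.single_apply]
    by_cases h : b.cells = insert q T.cells
    · have hpos : pos b.1.2 q.2 = leftCount T.cells q.2 := by
        rw [← b.columns_cells, b.isStaircase_cells.pos_columns, h, leftCount_insert_self]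
      rw [if_pos h, if_pos (Idx.cells_eq_insert_iff.1 h).2, hpos]
    · rw [if_neg h, if_neg fun h' => h (Idx.cells_eq_insert_iff.2 ⟨hq, h'⟩)]
  rw [dIdx, Finsupp.finsetSum_apply, Finset.sum_congr rfl fun q _ => hterm q.1 q.2,
    Finset.sum_attach (indexSet b.1.1 b.1.2) fun q =>
      if b.cells = insert q T.cells then (-1) ^ leftCount T.cells q.2 * X (toLex q) else 0]
  refine Finset.sum_subset (Finset.subset_univ _) fun x _ hx => if_neg fun h => hx ?_
  exact (Idx.cells_eq_insert_iff.1 h).1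

theorem diff_succ_apply (v : Idx n Δ (i + 1) →₀ Ring n m k) (T : Idx n Δ i) :
    (diff (i + 1) v : Idx n Δ i →₀ Ring n m k) T = ∑ x : Fin n × Fin m,
      (-1) ^ leftCount T.cells x.2 * (X (toLex x) *
        v.mapDomain Idx.cells (insert x T.cells)) := by
  induction v using Finsupp.induction_linear with
  | zero => simp only [map_zero, Finsupp.mapDomain_zero, Finsupp.zero_apply, mul_zero,
      Finset.sum_const_zero]
  | add v w hv hw =>
    rw [map_add, Finsupp.add_apply, hv, hw, Finsupp.mapDomain_add, ← Finset.sum_add_distrib]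
    simp only [Finsupp.add_apply, mul_add]
  | single b r =>
    rw [diff_single, Finsupp.smul_apply, dBasis, dIdx_apply, Finset.smul_sum]
    refine Finset.sum_congr rfl fun x _ => ?_
    rw [Finsupp.mapDomain_single, Finsupp.single_apply]
    split_ifs
    · rw [smul_eq_mul]
      ring
    · rw [smul_zero, mul_zero, mul_zero]

theorem coeff_diff_succ_apply (v : Idx n Δ (i + 1) →₀ Ring n m k) (T : Idx n Δ i)
    (s : Vars n m →₀ ℕ) :
    coeff s ((diff (i + 1) v : Idx n Δ i →₀ Ring n m k) T) = ∑ x : Fin n × Fin m,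
      (-1) ^ leftCount T.cells x.2 *
        if toLex x ∈ s.support then
          coeff (s - Finsupp.single (toLex x) 1) (v.mapDomain Idx.cells (insert x T.cells))
        else 0 := by
  rw [diff_succ_apply, coeff_sum]
  refine Finset.sum_congr rfl fun x _ => ?_
  rw [show ((-1) ^ leftCount T.cells x.2 : Ring n m k) = C ((-1) ^ leftCount T.cells x.2) by
    rw [map_pow, map_neg, map_one], coeff_C_mul, coeff_X_mul']

theorem coeff_single_eq_zero_of_diff_succ_eq_zero {v : Idx n Δ (i + 1) →₀ Ring n m k}
    (hv : (diff (i + 1) v : Idx n Δ i →₀ Ring n m k) = 0) (T : Idx n Δ i) (x : Fin n × Fin m)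
    (e : ℕ) :
    coeff (Finsupp.single (toLex x) e) (v.mapDomain Idx.cells (insert x T.cells)) = 0 := by
  have h := coeff_diff_succ_apply v T (Finsupp.single (toLex x) (e + 1))
  rw [hv, Finsupp.zero_apply, coeff_zero, Finset.sum_eq_single x] at h
  · rw [if_pos (by simp), ← Finsupp.single_tsub, Nat.add_sub_cancel] at h
    exact (mul_eq_zero.1 h.symm).resolve_left (pow_ne_zero _ (neg_ne_zero.2 one_ne_zero))
  · intro y _ hyx
    rw [if_neg (by simp [hyx.symm]), mul_zero]
  · exact fun h => absurd (Finset.mem_univ x) h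

theorem coeff_zero_eq_zero_of_diff_succ_eq_zero {v : Idx n Δ (i + 1) →₀ Ring n m k}
    (hv : (diff (i + 1) v : Idx n Δ i →₀ Ring n m k) = 0) (b : Idx n Δ (i + 1)) :
    coeff 0 (v b) = 0 := by
  obtain ⟨l, hl⟩ := exists_one_lt_card_row (P := b.cells) (by rw [b.card_cells]; omega)
  obtain ⟨x, hx⟩ := Finset.card_pos.1 (one_pos.trans hl)
  obtain ⟨hxb, rfl⟩ := mem_row.1 hx
  have hx := b.mem_indexSet_iff.2 ⟨hxb, hl⟩
  have h := coeff_single_eq_zero_of_diff_succ_eq_zero hv (b.remove x hx) x 0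
  rwa [← Idx.cells_eq_insert_iff.2 ⟨hx, rfl⟩, mapDomain_cells_apply, Finsupp.single_zero] at h

/-- The coefficient of the variable `x` at the basis element with staircase `P`, extended by zero
to all sets of cells. -/
def linearCoeff (v : Idx n Δ i →₀ Ring n m k) (P : Finset (Fin n × Fin m)) (x : Fin n × Fin m) :
    k :=
  coeff (Finsupp.single (toLex x) 1) (v.mapDomain Idx.cells P)

theorem linearCoeff_cells (v : Idx n Δ i →₀ Ring n m k) (b : Idx n Δ i) (x : Fin n × Fin m) :
    linearCoeff v b.cells x = coeff (Finsupp.single (toLex x) 1) (v b) := by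
  rw [linearCoeff, mapDomain_cells_apply]

theorem isFaceStaircase_of_linearCoeff_ne_zero {v : Idx n Δ i →₀ Ring n m k}
    (h : linearCoeff v P x ≠ 0) : IsFaceStaircase Δ i P := by
  refine isFaceStaircase_of_mapDomain_cells_ne_zero (v := v) fun h0 => h ?_
  rw [linearCoeff, h0, coeff_zero]

theorem isLinearCycle_linearCoeff {v : Idx n Δ (i + 1) →₀ Ring n m k}
    (hv : (diff (i + 1) v : Idx n Δ i →₀ Ring n m k) = 0) :
    IsLinearCycle Δ i (linearCoeff v) where
  isFaceStaircase _ _ h := isFaceStaircase_of_linearCoeff_ne_zero h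
  insert_self T x hT := by
    obtain ⟨T, rfl⟩ := hT.exists_cells_eq
    exact coeff_single_eq_zero_of_diff_succ_eq_zero hv T x 1
  insert_swap T x y hT hxy := by
    obtain ⟨T, rfl⟩ := hT.exists_cells_eq
    have h := coeff_diff_succ_apply v T
      (Finsupp.single (toLex x) 1 + Finsupp.single (toLex y) 1)
    rw [hv, Finsupp.zero_apply, coeff_zero,
      Finset.sum_eq_add_of_mem x y (Finset.mem_univ x) (Finset.mem_univ y) hxy] at h
    · rw [if_pos (by simp), if_pos (by simp), add_tsub_cancel_left, add_tsub_cancel_right] at h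
      exact h.symm
    · rintro z - ⟨hzx, hzy⟩
      rw [if_neg (by simp [hzx.symm, hzy.symm]), mul_zero]

/-- The exponent vector of the product of the variables in `P`. -/
def cellsExp (P : Finset (Fin n × Fin m)) : Vars n m →₀ ℕ :=
  ∑ q ∈ P, Finsupp.single (toLex q) 1

theorem cellsExp_apply (P : Finset (Fin n × Fin m)) (q : Fin n × Fin m) :
    cellsExp P (toLex q) = if q ∈ P then 1 else 0 := by
  simp [cellsExp, Finsupp.finsetSum_apply, Finsupp.single_apply]

theorem subset_insert_of_cellsExp_le (h : cellsExp Q ≤ cellsExp P + Finsupp.single (toLex x) 1) :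
    Q ⊆ insert x P := by
  intro q hq
  have h1 := h (toLex q)
  rw [Finsupp.add_apply, cellsExp_apply, cellsExp_apply, if_pos hq] at h1
  rw [Finset.mem_insert]
  by_contra! hcon
  simp [hcon.2, Ne.symm hcon.1] at h1

theorem cellsExp_le_iff : cellsExp Q ≤ cellsExp P ↔ Q ⊆ P := by
  refine ⟨fun h q hq => ?_, fun h => Finset.sum_le_sum_of_subset h⟩
  by_contra hqP
  have := h (toLex q)
  rw [cellsExp_apply, cellsExp_apply, if_pos hq, if_neg hqP] at this
  exact absurd this Nat.one_ne_zero.bot_lt.not_ge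

theorem initialMinor_eq_monomial (S : Idx n Δ 0) :
    initialMinor k S.1.2 (card_eq S) = monomial (cellsExp S.cells) 1 := by
  have hα (l : Fin n) : S.1.1 l = 0 := Finset.sum_eq_zero_iff.1 S.2.2.2 l (Finset.mem_univ l)
  have himage : Finset.univ.image (fun l => (l, S.1.2.orderEmbOfFin (card_eq S) l)) = S.cells := by
    refine Finset.eq_of_subset_of_card_le (fun q hq => ?_) ?_
    · obtain ⟨l, -, rfl⟩ := Finset.mem_image.1 hq
      refine mem_cells.2 ⟨Finset.orderEmbOfFin_mem _ _ _, ?_⟩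
      simp only [hα, Finset.sum_const_zero, add_zero, pos_orderEmbOfFin, le_refl, and_self]
    · rw [Finset.card_image_of_injective _ fun _ _ h => congrArg Prod.fst h, S.card_cells,
        Finset.card_univ, Fintype.card_fin, add_zero]
  rw [initialMinor_eq, cellsExp, monomial_sum_one, ← himage,
    Finset.prod_image fun _ _ _ _ h => congrArg Prod.fst h]
  rfl

theorem diff_zero_apply (v : Idx n Δ 0 →₀ Ring n m k) :
    (diff 0 v : Basis n Δ 0 →₀ Ring n m k) () =
      ∑ Q, v.mapDomain Idx.cells Q * monomial (cellsExp Q) 1 := by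
  induction v using Finsupp.induction_linear with
  | zero => simp only [map_zero, Finsupp.mapDomain_zero, Finsupp.zero_apply, zero_mul,
      Finset.sum_const_zero]
  | add v w hv hw =>
    rw [map_add (diff 0), Finsupp.add_apply, hv, hw, Finsupp.mapDomain_add,
      ← Finset.sum_add_distrib]
    simp only [Finsupp.add_apply, add_mul]
  | single S r =>
    rw [diff_single, Finsupp.smul_apply, dBasis, Finsupp.single_eq_same, smul_eq_mul,
      initialMinor_eq_monomial, Finsupp.mapDomain_single,
      Finset.sum_eq_single_of_mem S.cells (Finset.mem_univ _), Finsupp.single_eq_same]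
    intro Q _ hQ
    rw [Finsupp.single_eq_of_ne hQ, zero_mul]

theorem coeff_diff_zero_apply (v : Idx n Δ 0 →₀ Ring n m k) (s : Vars n m →₀ ℕ) :
    coeff s ((diff 0 v : Basis n Δ 0 →₀ Ring n m k) ()) =
      ∑ Q, if cellsExp Q ≤ s then coeff (s - cellsExp Q) (v.mapDomain Idx.cells Q) else 0 := by
  rw [diff_zero_apply, coeff_sum]
  simp only [coeff_mul_monomial', mul_one]

theorem coeff_eq_zero_of_diff_zero_eq_zero {v : Idx n Δ 0 →₀ Ring n m k}
    (hv : (diff 0 v : Basis n Δ 0 →₀ Ring n m k) = 0) (S : Idx n Δ 0) {s : Vars n m →₀ ℕ}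
    (hs : ∀ Q, cellsExp Q ≤ cellsExp S.cells + s → Q ⊆ S.cells) : coeff s (v S) = 0 := by
  have h := coeff_diff_zero_apply v (cellsExp S.cells + s)
  rw [hv, Finsupp.zero_apply, coeff_zero, Finset.sum_eq_single_of_mem _ (Finset.mem_univ S.cells),
    if_pos le_self_add, add_tsub_cancel_left, mapDomain_cells_apply] at h
  · exact h.symm
  · intro Q _ hQS
    split_ifs with hle
    · by_contra h0
      have hQ := isFaceStaircase_of_mapDomain_cells_ne_zero (v := v) (P := Q) fun h => h0 (by
        rw [h, coeff_zero])
      exact hQS (Finset.eq_of_subset_of_card_le (hs Q hle) (by rw [hQ.card_eq, S.card_cells]))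
    · rfl

theorem coeff_zero_eq_zero_of_diff_zero_eq_zero {v : Idx n Δ 0 →₀ Ring n m k}
    (hv : (diff 0 v : Basis n Δ 0 →₀ Ring n m k) = 0) (S : Idx n Δ 0) : coeff 0 (v S) = 0 :=
  coeff_eq_zero_of_diff_zero_eq_zero hv S fun _ h => cellsExp_le_iff.1 ((add_zero _).subst h)

theorem isInitialLinearCycle_linearCoeff {v : Idx n Δ 0 →₀ Ring n m k}
    (hv : (diff 0 v : Basis n Δ 0 →₀ Ring n m k) = 0) :
    IsInitialLinearCycle Δ (linearCoeff v) where
  isFaceStaircase _ _ h := isFaceStaircase_of_linearCoeff_ne_zero h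
  eq_zero_of_mem P x hx := by
    by_contra h
    obtain ⟨S, rfl⟩ := (isFaceStaircase_of_linearCoeff_ne_zero h).exists_cells_eq
    refine h ((linearCoeff_cells v S x).trans ?_)
    refine coeff_eq_zero_of_diff_zero_eq_zero hv S fun Q hQ => ?_
    rw [← Finset.insert_eq_of_mem hx]
    exact subset_insert_of_cellsExp_le hQ
  sum_erase P hP := by
    have h := coeff_diff_zero_apply v (cellsExp P)
    rw [hv, Finsupp.zero_apply, coeff_zero] at h
    rw [h, ← Finset.sum_subset (Finset.subset_univ (P.image P.erase)),
      Finset.sum_image (Finset.erase_injOn P)]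
    · refine Finset.sum_congr rfl fun x hx => ?_
      have hadd : cellsExp P = Finsupp.single (toLex x) 1 + cellsExp (P.erase x) :=
        (Finset.add_sum_erase P _ hx).symm
      rw [if_pos (cellsExp_le_iff.2 (Finset.erase_subset x P)), hadd, add_tsub_cancel_right,
        linearCoeff]
    · intro Q _ hQ
      split_ifs with hle
      · by_contra h0
        have hface := isFaceStaircase_of_mapDomain_cells_ne_zero (v := v) (P := Q) fun h => h0 (by
          rw [h, coeff_zero])
        obtain ⟨x, hx, rfl⟩ := Finset.exists_eq_insert_iff.2 ⟨cellsExp_le_iff.1 hle,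
          (congrArg (· + 1) hface.card_eq).trans hP.symm⟩
        exact hQ (Finset.mem_image.2
          ⟨x, Finset.mem_insert_self x Q, Finset.erase_insert hx⟩)
      · rfl

/-! ### Linear exactness -/

theorem eq_sum_X_mul_C {σ R : Type*} [Fintype σ] [CommSemiring R] {f : MvPolynomial σ R}
    (hf : ∀ s, coeff s f ≠ 0 → s.degree = 1) :
    f = ∑ x, X x * C (coeff (Finsupp.single x 1) f) := by
  classical
  ext s
  simp only [coeff_sum, mul_comm (X _), coeff_C_mul, coeff_X]
  by_cases hs : s.degree = 1
  · obtain ⟨x, rfl⟩ := (Finsupp.sum_eq_one_iff s).1 hs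
    rw [Finset.sum_eq_single_of_mem x (Finset.mem_univ x), if_pos rfl, mul_one]
    exact fun y _ hyx => by
      rw [if_neg fun h => hyx (Finsupp.single_left_injective one_ne_zero h), mul_zero]
  · rw [Finset.sum_eq_zero, not_not.1 (mt (hf s) hs)]
    intro x _
    rw [if_neg, mul_zero]
    rintro rfl
    exact hs (Finsupp.degree_single x 1)

theorem exists_diff_eq_of_weight {v : Idx n Δ i →₀ Ring n m k}
    {w : Finset (Fin n × Fin m) → k} (hv : ∀ b s, coeff s (v b) ≠ 0 → s.degree = 1)
    (hw : ∀ P, w P ≠ 0 → IsFaceStaircase Δ (i + 1) P)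
    (hvw : ∀ P x, IsFaceStaircase Δ i P →
      linearCoeff v P x = (-1) ^ leftCount P x.2 * w (insert x P)) :
    ∃ u : Idx n Δ (i + 1) →₀ Ring n m k, (∀ b s, coeff s (u b) ≠ 0 → s.degree = 0) ∧
      (diff (i + 1) u : Idx n Δ i →₀ Ring n m k) = v := by
  have := finite_Idx (n := n) (Δ := Δ) (i + 1)
  let u : Idx n Δ (i + 1) →₀ Ring n m k := Finsupp.equivFunOnFinite.symm fun b => C (w b.cells)
  have hu (P : Finset (Fin n × Fin m)) : u.mapDomain Idx.cells P = C (w P) := by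
    by_cases hP : IsFaceStaircase Δ (i + 1) P
    · obtain ⟨b, rfl⟩ := hP.exists_cells_eq
      exact mapDomain_cells_apply u b
    · rw [not_not.1 (mt isFaceStaircase_of_mapDomain_cells_ne_zero hP), not_not.1 (mt (hw P) hP),
        map_zero]
  refine ⟨u, fun b s hs => ?_, Finsupp.ext fun T => ?_⟩
  · by_contra hne
    refine hs ((coeff_C _ _).trans (if_neg fun h => hne ?_))
    rw [← h, map_zero]
  · rw [diff_succ_apply, eq_sum_X_mul_C (hv T)]
    refine (Finset.sum_congr rfl fun x _ => ?_).trans (toLex.sum_comp _)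
    rw [hu, ← linearCoeff_cells, hvw _ x T.isFaceStaircase_cells, map_mul, map_pow, map_neg,
      map_one]
    ring

theorem exists_diff_eq_of_diff_eq_zero
    (hΔ : ∀ σ : Finset (Fin m), n + 1 ≤ σ.card → ¬IsNonface Δ 1 σ) {v : Idx n Δ i →₀ Ring n m k}
    (hv : ∀ b s, coeff s (v b) ≠ 0 → s.degree = 1)
    (hdv : (diff i v : Basis n Δ i →₀ Ring n m k) = 0) :
    ∃ u : Idx n Δ (i + 1) →₀ Ring n m k, (∀ b s, coeff s (u b) ≠ 0 → s.degree = 0) ∧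
      (diff (i + 1) u : Idx n Δ i →₀ Ring n m k) = v := by
  obtain ⟨w, hw, hvw⟩ : ∃ w : Finset (Fin n × Fin m) → k,
      (∀ P, w P ≠ 0 → IsFaceStaircase Δ (i + 1) P) ∧ ∀ P x, IsFaceStaircase Δ i P →
        linearCoeff v P x = (-1) ^ leftCount P x.2 * w (insert x P) := by
    cases i with
    | zero =>
      have hc := isInitialLinearCycle_linearCoeff hdv
      exact exists_weight (fun _ _ => hc.isFaceStaircase_insert hΔ) fun _ _ _ => hc.sign_mul_eq
    | succ i =>
      have hc := isLinearCycle_linearCoeff hdv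
      exact exists_weight (fun _ _ => hc.isFaceStaircase_insert hΔ) fun _ _ _ => hc.sign_mul_eq
  exact exists_diff_eq_of_weight hv hw hvw

theorem isLinearlyExact_sparseENComplex
    (hΔ : ∀ σ : Finset (Fin m), n + 1 ≤ σ.card → ¬IsNonface Δ 1 σ) :
    (sparseENComplex n k Δ).IsLinearlyExact n where
  deg_eq _ _ := rfl
  eq_zero i v hv hdv := by
    refine Finsupp.ext fun b => MvPolynomial.ext _ _ fun s => ?_
    by_contra hs
    have hdeg : s.degree + (n + i) = n + i := hv b s hs
    obtain rfl : s = 0 := (Finsupp.degree_eq_zero_iff s).1 (Nat.add_eq_right.1 hdeg)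
    cases i with
    | zero => exact hs (coeff_zero_eq_zero_of_diff_zero_eq_zero hdv b)
    | succ i => exact hs (coeff_zero_eq_zero_of_diff_succ_eq_zero hdv b)
  exists_eq i v hv hdv := by
    have hdeg (b : Idx n Δ i) (s) (hs : coeff s (v b) ≠ 0) : s.degree = 1 := by
      have : s.degree + (n + i) = n + i + 1 := hv b s hs
      omega
    obtain ⟨u, hu, hdu⟩ := exists_diff_eq_of_diff_eq_zero hΔ hdeg hdv
    exact ⟨u, fun b s hs => (hu b s hs).symm ▸ Nat.zero_add _, hdu⟩

end Differential

end SparseEN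

end

theorem mainTheorem4 {k : Type u} [Field k] {n m : ℕ} (hn : 1 ≤ n) (hnm : n ≤ m)
    (Δ : PreAbstractSimplicialComplex (Fin m))
    (hdim : ∃ σ ∈ Δ, n ≤ σ.card)
    (hΔ : ∀ σ : Finset (Fin m), n + 1 ≤ σ.card → ¬ IsNonface Δ 1 σ) :
    (∃ (N : Type u) (_ : AddCommGroup N) (_ : Module (SparseEN.Ring n m k) N)
      (𝒩 : ℕ → AddSubgroup N),
      IsGradedModule (V := SparseEN.Vars n m) (k := k) 𝒩 ∧
      Module.Finite (SparseEN.Ring n m k) N ∧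
      HasInitialDegree 𝒩 n ∧
      IsAugmentedLinearStrand (SparseEN.sparseENComplex n k Δ) 𝒩 n) ∧
    ∀ i : ℕ, 1 ≤ i →
      Subsingleton ((SparseEN.sparseENComplex n k Δ).homology i (i + n - 1)) ∧
      Subsingleton ((SparseEN.sparseENComplex n k Δ).homology i (i + n)) := by
  have hC := SparseEN.isLinearlyExact_sparseENComplex (k := k) hΔ
  constructor
  · have : Finite (SparseEN.Vars n m) := inferInstanceAs (Finite (Fin n × Fin m))
    have := (SparseEN.sparseENComplex n k Δ).finite_B 1
    obtain ⟨σ, hσ, hσn⟩ := hdim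
    obtain ⟨τ, hτσ, hτ⟩ := Finset.exists_subset_card_eq hσn
    have hτΔ : τ ∈ Δ := (Δ.isRelLowerSet_faces hσ).2 hτσ (Finset.card_pos.1 (by omega))
    exact ⟨LinearMap.range ((SparseEN.sparseENComplex n k Δ).d 0), inferInstance, inferInstance,
      GradedFree.submoduleGrading _ _,
      (GradedFreeComplex.isHomogeneousMap_d _ 0).isGradedSubmodule_range.isGradedModule,
      Module.Finite.range _,
      GradedFree.hasInitialDegree_range hC ⟨(0, τ), hτΔ, hτ, by simp⟩,
      GradedFree.isAugmentedLinearStrand_range hC⟩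
  · intro i hi
    obtain ⟨i, rfl⟩ := Nat.exists_eq_add_of_le' hi
    rw [show i + 1 + n - 1 = n + i by omega, show i + 1 + n = n + i + 1 by omega]
    refine ⟨GradedFreeComplex.subsingleton_homology _ fun v hv hdv => ?_,
      GradedFreeComplex.subsingleton_homology _ (hC.exists_eq i)⟩
    exact ⟨0, AddSubgroup.zero_mem _, by rw [map_zero, hC.eq_zero i v hv hdv]⟩
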